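/- Let $\varphi,\psi$ be independent random variables, each uniformly distributed on $[0,\pi/2]$, and put $$a=\sin\varphi\cos\psi,\qquad b=\sin\varphi\sin\psi,\qquad c=\sqrt{1-a^2-b^2},$$ so that $a^2+b^2+c^2=1$. Let $T$ be the event that $a,b,c$ are the sides of a (nondegenerate) triangle, that is, $a<b+c$, $b<a+c$ and $c<a+b$. On $T$ let $\alpha,\beta$ be the angles opposite $a,b$, i.e. $\alpha=\arccos\frac{b^2+c^2-a^2}{2bc}$ and $\beta=\arccos\frac{a^2+c^2-b^2}{2ac}$. Then $\mathbb P(T)>0$, and there is a constant $C>0$ such that, conditionally on $T$: 1. the pair $(a,b)$ has the joint density (with respect to Lebesgue measure on $\mathbb R^2$) $$\frac{C}{\sqrt{x^2+y^2}\,\sqrt{1-x^2-y^2}}\quad\text{if } |x-y|<\sqrt{1-x^2-y^2}<x+y,$$ and $0$ otherwise (in particular $0$ where $x^2+y^2>1$); 2. the pair $(\alpha,\beta)$ has the joint density $$\frac{C\,\sin x\,\sin y\,\sin(x+y)}{\bigl(\sin^2x+\sin^2y+\sin^2(x+y)\bigr)\sqrt{\sin^2x+\sin^2y}}\quad\text{if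 } 0<x<\pi,\ 0<y<\pi,\ x+y<\pi,$$ and $0$ otherwise. The normalizing constant $C$ satisfies $$\begin{aligned}\frac1C&=2\int_0^1\frac{\arctan\bigl(x\sqrt{1+x^2}\bigr)}{1+x^2}\,dx =\frac{\pi}{2}\arctan\sqrt2-2\int_0^1\frac{(1+2x^2)\arctan x}{\sqrt{1+x^2}\,(1+x^2+x^4)}\,dx\\ &=-\frac{\pi^2}{24}-\frac12 i\pi\ln(2-\sqrt3)-\operatorname{Li}_2\bigl(\sqrt{2-\sqrt3}\bigr)+\operatorname{Li}_2\bigl(-\sqrt{2-\sqrt3}\bigr)-\operatorname{Li}_2\bigl(-\sqrt{2+\sqrt3}\bigr)+\operatorname{Li}_2\bigl(\sqrt{2+\sqrt3}\bigr)\\ &\quad+\operatorname{Li}_2\Bigl(\frac{1-i}{1+\sqrt3}\Bigr)+\operatorname{Li}_2\Bigl(\frac{1+i}{1+\sqrt3}\Bigr)+\operatorname{Li}_2\Bigl(\frac{1+\sqrt3}{-1+i}\Bigr)+\operatorname{Li}_2\Bigl(\frac{1+\sqrt3}{-1-i}\Bigr)\\ &=0.6947951075\ldots\end{aligned}$$ (that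 is, $0.6947951075\le 1/C<0.6947951076$). Here $\operatorname{Li}_2(z)=-\int_0^z\frac{\log(1-t)}{t}\,dt$ is the dilogarithm, the integral being taken along the straight segment from $0$ to $z$ with the principal logarithm; for real $z>1$ this means $\log(1-t)=\ln|1-t|+i\pi$ for $t>1$. -/

import Mathlib

open MeasureTheory ProbabilityTheory

noncomputable section

/-- The three sides form a (nondegenerate) triangle. -/
def FormsTriangle (a b c : ℝ) : Prop :=
  a < b + c ∧ b < a + c ∧ c < a + b

/-- The angle opposite the side `a` in a triangle with sides `a`, `b`, `c`,
given by the Law of Cosines. -/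
def angleOpp (a b c : ℝ) : ℝ :=
  Real.arccos ((b ^ 2 + c ^ 2 - a ^ 2) / (2 * b * c))

/-- The first side `a = sin φ cos ψ`. -/
def sideA (φ ψ : ℝ) : ℝ := Real.sin φ * Real.cos ψ

/-- The second side `b = sin φ sin ψ`. -/
def sideB (φ ψ : ℝ) : ℝ := Real.sin φ * Real.sin ψ

/-- The third side, determined by `a ^ 2 + b ^ 2 + c ^ 2 = 1` and `0 ≤ c`. -/
def sideC (φ ψ : ℝ) : ℝ := √(1 - sideA φ ψ ^ 2 - sideB φ ψ ^ 2)

/-- The angle `α` opposite the side `a`. -/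
def angleA (φ ψ : ℝ) : ℝ := angleOpp (sideA φ ψ) (sideB φ ψ) (sideC φ ψ)

/-- The angle `β` opposite the side `b`. -/
def angleB (φ ψ : ℝ) : ℝ := angleOpp (sideB φ ψ) (sideA φ ψ) (sideC φ ψ)

open Classical in
/-- The bivariate side density with normalizing constant `C`. -/
def sideDensity (C x y : ℝ) : ℝ :=
  if |x - y| < √(1 - x ^ 2 - y ^ 2) ∧ √(1 - x ^ 2 - y ^ 2) < x + y then
    C / (√(x ^ 2 + y ^ 2) * √(1 - x ^ 2 - y ^ 2))
  else 0

open Classical in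
/-- The bivariate angle density with normalizing constant `C`. -/
def angleDensity (C x y : ℝ) : ℝ :=
  if 0 < x ∧ x < Real.pi ∧ 0 < y ∧ y < Real.pi ∧ x + y < Real.pi then
    C * Real.sin x * Real.sin y * Real.sin (x + y) /
      ((Real.sin x ^ 2 + Real.sin y ^ 2 + Real.sin (x + y) ^ 2) *
        √(Real.sin x ^ 2 + Real.sin y ^ 2))
  else 0

/-- The principal branch of the dilogarithm, `Li₂ z = - ∫_0^z log (1 - s) / s ds`, the integral
being taken along the segment from `0` to `z` (parametrized by `s = t z`, `0 ≤ t ≤ 1`) with the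
principal logarithm. For `|z| ≤ 1` this is `∑_{k ≥ 1} z ^ k / k ^ 2`; on the cut `z > 1`, where
`log (1 - s) = log |1 - s| + i π` for `s > 1`, it is the boundary value from below. -/
def dilog (z : ℂ) : ℂ :=
  -∫ t in (0 : ℝ)..1, Complex.log (1 - (t : ℂ) * z) / (t : ℂ)

end

/-! Given `T`, the pair (φ, ψ) is uniform on `paramRegion`, a part of the open square, and 1/C is
the area V of that region. The map (φ, ψ) ↦ (a, b) is injective there with Jacobian sin φ cos φ =
√(a² + b²) · c, which gives the side density (`map_sideMap_restrict_paramRegion`). By the law of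
sines the sides are the sines of the angles divided by the root of their sum of squares. The
Jacobian of this inverse map turns the side density into the angle density
(`map_sidesOfAngles_withDensity`, `map_angleMap_withDensity`).

For fixed ψ the triangle condition reads |cos ψ - sin ψ| < cot φ < cos ψ + sin ψ. Hence V is the
integral over [0, π/2] of arctan(cos ψ + sin ψ) - arctan|cos ψ - sin ψ|. Symmetry about π/4 and x =
tan ψ give the first formula for 1/C, and integration by parts gives the second.

For the closed form, put q = √(2 - √3), so that 2q/(1 - q²) = √2, and let χ(z) = (Li₂(z) -
Li₂(-z))/2. Then arctan(√2 cos t) is the t-derivative of 2 Re χ(q i e^{-it}), and V becomes a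
combination of its integrals over [0, π/4] and [0, π/2]. The latter is 2χ(q). The former is
elementary: w = q e^{iπ/4} satisfies (1 - w)/(1 + w) = w̄, so Landen's equation for χ evaluates χ(w)
+ χ(w̄). Thus V = 3π²/8 - 2 log² q - 4χ(q) (`two_mul_integral_arctan_eq`). The stated dilogarithms
reduce to the same value by inversion (`dilog_combination`), and the decimals come from rapidly
convergent series. -/

/-! ### The dilogarithm: integrability, power series, inversion, derivative. -/

theorem intervalIntegrable_log_one_sub_mul_div (z : ℂ) {b : ℝ} (hb : 0 ≤ b) :
    IntervalIntegrable (fun t : ℝ => Complex.log (1 - t * z) / (t : ℂ)) volume 0 b := by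
  -- For t ≤ ε one has ‖tz‖ ≤ 1/2, so log(1 - tz) = O(t). Beyond ε the factor 1/t is bounded, the
  -- imaginary part of the logarithm is at most π in modulus, and log‖1 - tz‖ is integrable even
  -- across a zero of 1 - tz.
  set ε : ℝ := 1 / (2 * (‖z‖ + 1)) with hε
  have hε0 : 0 < ε := by positivity
  have hlog : IntervalIntegrable (fun t : ℝ => Real.log ‖1 - (t : ℂ) * z‖) volume 0 b := by
    apply MeromorphicOn.intervalIntegrable_log_norm
    intro t _
    apply AnalyticAt.meromorphicAt
    have : AnalyticAt ℝ (fun t : ℝ => (t : ℂ)) t := Complex.ofRealCLM.analyticAt t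
    fun_prop
  have hbd : IntervalIntegrable
      (fun t : ℝ => 3 / 2 * ‖z‖ + (|Real.log ‖1 - (t : ℂ) * z‖| + Real.pi) * ε⁻¹) volume 0 b :=
    intervalIntegrable_const.add ((hlog.abs.add intervalIntegrable_const).mul_const _)
  refine hbd.mono_fun' (Measurable.aestronglyMeasurable (by fun_prop)) ?_
  rw [Filter.EventuallyLE, ae_restrict_iff' measurableSet_uIoc]
  refine Filter.Eventually.of_forall fun t ht => ?_
  rw [Set.uIoc_of_le hb] at ht
  have ht0 : 0 < t := ht.1
  rw [norm_div, Complex.norm_real, Real.norm_of_nonneg ht0.le]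
  by_cases hte : t ≤ ε
  · have h1 : ‖-((t : ℂ) * z)‖ ≤ 1 / 2 := by
      rw [norm_neg, norm_mul, Complex.norm_real, Real.norm_of_nonneg ht0.le]
      calc t * ‖z‖ ≤ ε * (‖z‖ + 1) := by gcongr; linarith
        _ = 1 / 2 := by rw [hε]; field_simp
    have h2 := Complex.norm_log_one_add_half_le_self h1
    rw [norm_neg, norm_mul, Complex.norm_real, Real.norm_of_nonneg ht0.le, ← sub_eq_add_neg] at h2
    have h3 : ‖Complex.log (1 - t * z)‖ / t ≤ 3 / 2 * ‖z‖ := by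
      rw [div_le_iff₀ ht0]; linarith
    have : 0 ≤ (|Real.log ‖1 - (t : ℂ) * z‖| + Real.pi) * ε⁻¹ := by positivity
    linarith
  · push Not at hte
    have h2 : ‖Complex.log (1 - t * z)‖ ≤ |Real.log ‖1 - (t : ℂ) * z‖| + Real.pi := by
      refine (Complex.norm_le_abs_re_add_abs_im _).trans ?_
      rw [Complex.log_re, Complex.log_im]
      gcongr
      exact Complex.abs_arg_le_pi _
    have : ‖Complex.log (1 - t * z)‖ / t ≤ (|Real.log ‖1 - (t : ℂ) * z‖| + Real.pi) * ε⁻¹ := by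
      rw [div_eq_mul_inv]
      gcongr
    have : 0 ≤ 3 / 2 * ‖z‖ := by positivity
    linarith

/-- The power series of the dilogarithm on the closed unit disc. -/
theorem hasSum_dilog {z : ℂ} (hz : ‖z‖ ≤ 1) :
    HasSum (fun n : ℕ => z ^ (n + 1) / ((n : ℂ) + 1) ^ 2) (dilog z) := by
  have hint : ∀ n : ℕ, IntervalIntegrable
      (fun t : ℝ => (t : ℂ) ^ n * (z ^ (n + 1) / ((n : ℂ) + 1))) volume 0 1 := fun n => by
    apply Continuous.intervalIntegrable; fun_prop
  have key := hasSum_integral_of_summable_integral_norm (μ := volume.restrict (Set.Ioc (0 : ℝ) 1))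
    (F := fun (n : ℕ) (t : ℝ) => (t : ℂ) ^ n * (z ^ (n + 1) / ((n : ℂ) + 1)))
    (fun n => (intervalIntegrable_iff_integrableOn_Ioc_of_le zero_le_one).1 (hint n)) ?_
  · have h1 : ∀ n : ℕ, ∫ t in Set.Ioc (0 : ℝ) 1, (t : ℂ) ^ n * (z ^ (n + 1) / ((n : ℂ) + 1)) =
        z ^ (n + 1) / ((n : ℂ) + 1) ^ 2 := fun n => by
      rw [← intervalIntegral.integral_of_le zero_le_one, intervalIntegral.integral_mul_const]
      have : ∫ t in (0 : ℝ)..1, (t : ℂ) ^ n = 1 / ((n : ℂ) + 1) := by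
        have := integral_pow (a := 0) (b := 1) n
        simp only [← Complex.ofReal_pow, intervalIntegral.integral_ofReal, this]
        simp
      rw [this]; field_simp
    simp only [h1] at key
    have hd : dilog z = ∫ t in Set.Ioc (0 : ℝ) 1,
        ∑' n : ℕ, (t : ℂ) ^ n * (z ^ (n + 1) / ((n : ℂ) + 1)) := ?_
    · rwa [hd]
    rw [dilog, intervalIntegral.integral_of_le zero_le_one, ← integral_neg]
    refine integral_congr_ae ?_
    -- When ‖z‖ = 1 the logarithmic series needs ‖tz‖ < 1, so the endpoint is discarded.
    have hne : ∀ᵐ t : ℝ ∂volume.restrict (Set.Ioc (0 : ℝ) 1), t ≠ 1 :=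
      ae_restrict_of_ae (by simp [ae_iff, measure_singleton])
    filter_upwards [hne, ae_restrict_mem measurableSet_Ioc] with t ht1 ht
    have ht0 : (t : ℂ) ≠ 0 := by exact_mod_cast ht.1.ne'
    have hlt : ‖(t : ℂ) * z‖ < 1 := by
      rw [norm_mul, Complex.norm_real, Real.norm_of_nonneg ht.1.le]
      have : t < 1 := lt_of_le_of_ne ht.2 ht1
      nlinarith [norm_nonneg z, ht.1]
    have hs := (hasSum_nat_add_iff' 1).2 (Complex.hasSum_taylorSeries_neg_log hlt)
    have hs2 := hs.mul_left (1 / (t : ℂ))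
    simp only [Finset.range_one, Finset.sum_singleton, pow_zero, Nat.cast_zero, div_zero,
      sub_zero] at hs2
    rw [← neg_div, div_eq_inv_mul, ← one_div, ← hs2.tsum_eq]
    refine tsum_congr fun n => ?_
    push_cast
    have : (n : ℂ) + 1 ≠ 0 := Nat.cast_add_one_ne_zero n
    field_simp
    ring
  · have hs : Summable fun n : ℕ => 1 / ((n : ℝ) + 1) ^ 2 := by
      have := (summable_nat_add_iff 1).2 (Real.summable_one_div_nat_pow.2 one_lt_two)
      simpa using this
    refine hs.of_nonneg_of_le (fun n => integral_nonneg fun t => norm_nonneg _) fun n => ?_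
    have : ∀ t ∈ Set.Ioc (0 : ℝ) 1, ‖(t : ℂ) ^ n * (z ^ (n + 1) / ((n : ℂ) + 1))‖ =
        t ^ n * (‖z‖ ^ (n + 1) / ((n : ℝ) + 1)) := fun t ht => by
      have h2 : ‖(n : ℂ) + 1‖ = (n : ℝ) + 1 := by
        rw [show (n : ℂ) + 1 = ((n + 1 : ℕ) : ℂ) by push_cast; rfl, Complex.norm_natCast]
        push_cast; rfl
      rw [norm_mul, norm_div, norm_pow, norm_pow, Complex.norm_real,
        Real.norm_of_nonneg ht.1.le, h2]
    rw [setIntegral_congr_fun measurableSet_Ioc this,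
      ← intervalIntegral.integral_of_le zero_le_one, intervalIntegral.integral_mul_const,
      integral_pow]
    have h1 : ‖z‖ ^ (n + 1) ≤ 1 := pow_le_one₀ (norm_nonneg _) hz
    have : (0 : ℝ) < n + 1 := by positivity
    simp only [one_pow, ne_eq, Nat.add_eq_zero_iff, one_ne_zero, and_false, not_false_eq_true,
      zero_pow, sub_zero]
    rw [div_mul_div_comm, one_mul, ← sq]
    gcongr

theorem dilog_conj {z : ℂ} (hz : ‖z‖ ≤ 1) :
    dilog ((starRingEnd ℂ) z) = (starRingEnd ℂ) (dilog z) := by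
  have h1 := hasSum_dilog (z := (starRingEnd ℂ) z) (by simpa using hz)
  have h2 := Complex.hasSum_conj'.2 (hasSum_dilog hz)
  refine h1.unique ?_
  convert h2 using 2 with n
  simp

/-- The two series add up to 2 ∑ cos(2πnx)/n², the Fourier series of a multiple of the Bernoulli
polynomial B₂(x) = x² - x + 1/6. -/
theorem dilog_add_dilog_conj_exp {x : ℝ} (hx : x ∈ Set.Icc (0 : ℝ) 1) :
    dilog (Complex.exp ((2 * Real.pi * x : ℝ) * Complex.I)) +
      dilog (Complex.exp (-((2 * Real.pi * x : ℝ) * Complex.I))) =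
      ((2 * Real.pi ^ 2 * (x ^ 2 - x + 1 / 6) : ℝ) : ℂ) := by
  have hn : ∀ y : ℝ, ‖Complex.exp (y * Complex.I)‖ ≤ 1 := fun y => by
    rw [Complex.norm_exp_ofReal_mul_I]
  have h1 := (hasSum_dilog (hn (2 * Real.pi * x))).add (hasSum_dilog (hn (-(2 * Real.pi * x))))
  have h2 := (hasSum_nat_add_iff' 1).2 (hasSum_one_div_nat_pow_mul_cos one_ne_zero hx)
  have h3 := (h2.mul_left 2)
  have h4 := Complex.hasSum_ofReal.2 h3
  have hB : Polynomial.eval x (Polynomial.map (algebraMap ℚ ℝ) (Polynomial.bernoulli (2 * 1))) =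
      x ^ 2 - x + 1 / 6 := by
    have : Polynomial.bernoulli 2 = Polynomial.X ^ 2 - Polynomial.X + Polynomial.C (1 / 6 : ℚ) := by
      rw [Polynomial.bernoulli]
      simp [Finset.sum_range_succ, bernoulli_eq_bernoulli'_of_ne_one, bernoulli'_two, bernoulli_one,
        ← Polynomial.C_mul_X_pow_eq_monomial]
      have h2 : (Polynomial.C (-1 / 2 : ℚ)) * 2 = -1 := by
        rw [← Polynomial.C_ofNat, ← Polynomial.C_mul]; norm_num
      linear_combination Polynomial.X * h2
    rw [mul_one, this]
    simp
  rw [hB] at h4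
  rw [show -((2 * Real.pi * x : ℝ) * Complex.I) = ((-(2 * Real.pi * x) : ℝ) : ℂ) * Complex.I by
    push_cast; ring]
  refine (h1.unique (a₂ := ((2 * ((-1 : ℝ) ^ (1 + 1) * (2 * Real.pi) ^ (2 * 1) / 2 /
    ((2 * 1).factorial : ℕ) * (x ^ 2 - x + 1 / 6)) : ℝ) : ℂ)) ?_).trans ?_
  · simp only [Finset.range_one, Finset.sum_singleton, Nat.cast_zero] at h4
    rw [show (1 : ℝ) / 0 ^ (2 * 1) = 0 by norm_num, zero_mul, sub_zero] at h4
    refine h4.congr_fun ?_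
    intro n
    rw [← Complex.exp_nat_mul, ← Complex.exp_nat_mul]
    push_cast
    rw [Complex.cos]
    field_simp
  · congr 1
    norm_num [Nat.factorial]
    ring

/-- Moving the modulus into the upper limit makes dilogarithms on one ray differ by an integral over
a subinterval. -/
theorem dilog_ofReal_mul {r : ℝ} (hr : 0 < r) (u : ℂ) :
    dilog (r * u) = -∫ s in (0 : ℝ)..r, Complex.log (1 - s * u) / (s : ℂ) := by
  have h := intervalIntegral.smul_integral_comp_mul_right
    (fun s : ℝ => Complex.log (1 - s * u) / (s : ℂ)) r (a := 0) (b := 1)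
  rw [zero_mul, one_mul] at h
  rw [dilog, ← h, ← intervalIntegral.integral_smul]
  congr 1
  refine intervalIntegral.integral_congr fun t _ => ?_
  have : (r : ℂ) ≠ 0 := by exact_mod_cast hr.ne'
  simp only [Complex.real_smul, Complex.ofReal_mul]
  rw [mul_assoc (t : ℂ) r u]
  by_cases ht : (t : ℂ) = 0
  · simp [ht]
  · field_simp

theorem integral_log_div_self {r : ℝ} (hr : 1 < r) :
    ∫ v in (r⁻¹)..1, Real.log v / v = -(Real.log r ^ 2 / 2) := by
  have hr0 : 0 < r⁻¹ := by positivity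
  have hpos : ∀ x ∈ Set.uIcc r⁻¹ 1, 0 < x := fun x hx => by
    rw [Set.uIcc_of_le (inv_le_one_of_one_le₀ hr.le)] at hx
    exact hr0.trans_le hx.1
  rw [intervalIntegral.integral_eq_sub_of_hasDerivAt (f := fun v => Real.log v ^ 2 / 2)]
  · simp
  · intro x hx
    refine (((Real.hasDerivAt_log (hpos x hx).ne').pow 2).div_const 2).congr_deriv ?_
    push_cast
    ring
  · apply ContinuousOn.intervalIntegrable
    intro x hx
    have := (hpos x hx).ne'
    exact ((Real.continuousAt_log this).div continuousAt_id this).continuousWithinAt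

/-- The inversion formula for the dilogarithm along a ray. -/
theorem dilog_inversion {r : ℝ} (hr : 1 < r) {u u' : ℂ}
    (hlog : ∀ v ∈ Set.Ioo (0 : ℝ) 1,
      Complex.log (1 - (v : ℂ)⁻¹ * u) = Complex.log (1 - v * u') + Complex.log (-u) - Real.log v) :
    dilog (r * u) = dilog u + dilog u' - dilog ((r : ℂ)⁻¹ * u')
      - Complex.log (-u) * Real.log r - Real.log r ^ 2 / 2 := by
  have hr0 : 0 < r := by linarith
  have hri : 0 < r⁻¹ := by positivity
  have hri1 : r⁻¹ < 1 := inv_lt_one_of_one_lt₀ hr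
  have i1 := intervalIntegrable_log_one_sub_mul_div u zero_le_one
  have i2 := intervalIntegrable_log_one_sub_mul_div u hr0.le
  have j1 := intervalIntegrable_log_one_sub_mul_div u' zero_le_one
  have j2 := intervalIntegrable_log_one_sub_mul_div u' hri.le
  have e1 := intervalIntegral.integral_add_adjacent_intervals i1 (i1.symm.trans i2)
  have e2 := intervalIntegral.integral_add_adjacent_intervals j2 (j2.symm.trans j1)
  have d1 := dilog_ofReal_mul hr0 u
  have d2 := dilog_ofReal_mul hri u'
  have d3 := dilog_ofReal_mul one_pos u
  have d4 := dilog_ofReal_mul one_pos u'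
  rw [Complex.ofReal_one, one_mul] at d3 d4
  rw [Complex.ofReal_inv] at d2
  -- The substitution s = 1/v carries the excess integral over [1, r] to [1/r, 1]; there `hlog`, the
  -- branch identity peculiar to each ray, returns a dilogarithm integrand plus elementary terms.
  have sub := intervalIntegral.integral_deriv_smul_comp_of_deriv_nonpos (a := r⁻¹) (b := 1)
    (f := fun v : ℝ => v⁻¹) (f' := fun v => -(v ^ 2)⁻¹)
    (g := fun s : ℝ => Complex.log (1 - s * u) / (s : ℂ)) ?_ ?_ ?_
  · have hnum : ∫ v in (r⁻¹)..1, (-(v ^ 2)⁻¹ : ℝ) •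
        ((fun s : ℝ => Complex.log (1 - s * u) / (s : ℂ)) ∘ fun v : ℝ => v⁻¹) v =
        ∫ v in (r⁻¹)..1, (-(Complex.log (1 - v * u') / (v : ℂ)) - Complex.log (-u) * (1 / v : ℝ)
          + ((Real.log v / v : ℝ) : ℂ)) := by
      refine intervalIntegral.integral_congr_ae ?_
      have hne : ∀ᵐ t : ℝ, t ≠ 1 := by simp [ae_iff, measure_singleton]
      filter_upwards [hne] with v hv1 hv
      rw [Set.uIoc_of_le hri1.le] at hv
      have hv0 : 0 < v := hri.trans hv.1
      have hvc : (v : ℂ) ≠ 0 := by exact_mod_cast hv0.ne'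
      have := hlog v ⟨hv0, lt_of_le_of_ne hv.2 hv1⟩
      simp only [Function.comp, Complex.ofReal_inv, this, Complex.real_smul]
      push_cast
      field_simp
      ring
    have c1 : IntervalIntegrable (fun v : ℝ => (1 / v : ℝ)) volume r⁻¹ 1 := by
      apply ContinuousOn.intervalIntegrable
      intro x hx
      rw [Set.uIcc_of_le hri1.le] at hx
      have : x ≠ 0 := (hri.trans_le hx.1).ne'
      exact (continuousAt_const.div continuousAt_id this).continuousWithinAt
    have c2 : IntervalIntegrable (fun v : ℝ => Real.log v / v) volume r⁻¹ 1 := by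
      apply ContinuousOn.intervalIntegrable
      intro x hx
      rw [Set.uIcc_of_le hri1.le] at hx
      have : x ≠ 0 := (hri.trans_le hx.1).ne'
      exact ((Real.continuousAt_log this).div continuousAt_id this).continuousWithinAt
    have hone : ∫ v in (r⁻¹)..1, (1 / v : ℝ) = Real.log r := by
      rw [integral_one_div_of_pos hri one_pos]; simp
    have c1' : IntervalIntegrable (fun v : ℝ => ((1 / v : ℝ) : ℂ)) volume r⁻¹ 1 :=
      ⟨c1.1.ofReal, c1.2.ofReal⟩
    have c2' : IntervalIntegrable (fun v : ℝ => ((Real.log v / v : ℝ) : ℂ)) volume r⁻¹ 1 :=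
      ⟨c2.1.ofReal, c2.2.ofReal⟩
    have j3 : IntervalIntegrable (fun v : ℝ => -(Complex.log (1 - v * u') / (v : ℂ)))
        volume r⁻¹ 1 := (j2.symm.trans j1).neg
    rw [hnum, intervalIntegral.integral_add (j3.sub (c1'.const_mul _)) c2',
      intervalIntegral.integral_sub j3 (c1'.const_mul _),
      intervalIntegral.integral_neg, intervalIntegral.integral_const_mul,
      intervalIntegral.integral_ofReal, intervalIntegral.integral_ofReal, hone,
      integral_log_div_self hr, inv_inv, inv_one, intervalIntegral.integral_symm 1 r] at sub
    push_cast at sub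
    rw [d1, d2, d3, d4]
    linear_combination e1 - e2 - sub
  · intro x hx
    rw [Set.uIcc_of_le hri1.le] at hx
    exact (continuousAt_inv₀ (hri.trans_le hx.1).ne').continuousWithinAt
  · intro x hx
    rw [min_eq_left hri1.le, max_eq_right hri1.le] at hx
    exact (hasDerivAt_inv (hri.trans hx.1).ne')
  · intro x _
    have : 0 ≤ (x ^ 2)⁻¹ := by positivity
    linarith

theorem one_sub_mem_slitPlane {z : ℂ} (hz : ‖z‖ < 1) : 1 - z ∈ Complex.slitPlane := by
  left
  have := (Complex.abs_re_le_norm z).trans_lt hz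
  rw [abs_lt] at this
  simp; linarith

/-- Differentiation under the integral: on a ball of radius ρ < 1 one has |1 - tx| ≥ 1 - ρ, which
dominates the derivative of the integrand. -/
theorem hasDerivAt_dilog {z : ℂ} (hz : ‖z‖ < 1) (hz0 : z ≠ 0) :
    HasDerivAt dilog (-(Complex.log (1 - z) / z)) z := by
  obtain ⟨ρ, hρ1, hρ2⟩ := exists_between hz
  have hmem : ∀ t ∈ Set.Icc (0 : ℝ) 1, ∀ x ∈ Metric.ball (0 : ℂ) ρ, ‖(t : ℂ) * x‖ < ρ :=
    fun t ht x hx => by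
      rw [mem_ball_zero_iff] at hx
      rw [norm_mul, Complex.norm_real, Real.norm_of_nonneg ht.1]
      nlinarith [norm_nonneg x, ht.2]
  have key := intervalIntegral.hasDerivAt_integral_of_dominated_loc_of_deriv_le (μ := volume)
    (F := fun (x : ℂ) (t : ℝ) => Complex.log (1 - t * x) / (t : ℂ))
    (F' := fun (x : ℂ) (t : ℝ) => -(1 - t * x)⁻¹) (x₀ := z) (s := Metric.ball 0 ρ)
    (bound := fun _ => (1 - ρ)⁻¹) (a := 0) (b := 1)
    (Metric.isOpen_ball.mem_nhds (by simpa using hρ1))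
    (Filter.Eventually.of_forall fun x => Measurable.aestronglyMeasurable (by fun_prop))
    (intervalIntegrable_log_one_sub_mul_div z zero_le_one)
    (Measurable.aestronglyMeasurable (by fun_prop))
    (Filter.Eventually.of_forall fun t ht x hx => ?_) intervalIntegrable_const
    (Filter.Eventually.of_forall fun t ht x hx => ?_)
  · have hI : ∫ t in (0 : ℝ)..1, -(1 - (t : ℂ) * z)⁻¹ = Complex.log (1 - z) / z := by
      rw [intervalIntegral.integral_eq_sub_of_hasDerivAt
        (f := fun t : ℝ => Complex.log (1 - t * z) / z)]
      · simp
      · intro t ht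
        rw [Set.uIcc_of_le zero_le_one] at ht
        have hlt := (hmem t ht z (by simpa using hρ1)).trans hρ2
        have h1 : HasDerivAt (fun t : ℝ => 1 - (t : ℂ) * z) (-z) t := by
          simpa using ((Complex.ofRealCLM.hasDerivAt (x := t)).mul_const z).const_sub 1
        have h2 := (h1.clog_real (one_sub_mem_slitPlane hlt)).div_const z
        refine h2.congr_deriv ?_
        rw [div_div, mul_comm, ← div_div, neg_div, div_self hz0, neg_div, one_div]
      · apply ContinuousOn.intervalIntegrable
        intro t ht
        rw [Set.uIcc_of_le zero_le_one] at ht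
        have hlt := (hmem t ht z (by simpa using hρ1)).trans hρ2
        have := Complex.slitPlane_ne_zero (one_sub_mem_slitPlane hlt)
        refine ContinuousAt.continuousWithinAt ?_
        exact ((continuousAt_const.sub
          (Complex.continuous_ofReal.continuousAt.mul continuousAt_const)).inv₀ this).neg
    have := key.2.neg
    rw [hI] at this
    exact this
  · rw [Set.uIoc_of_le zero_le_one] at ht
    have h1 := hmem t ⟨ht.1.le, ht.2⟩ x hx
    rw [norm_neg, norm_inv]
    have : 1 - ρ ≤ ‖1 - (t : ℂ) * x‖ := by
      have := norm_sub_norm_le (1 : ℂ) (t * x)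
      rw [norm_one] at this
      linarith
    gcongr
  · rw [Set.uIoc_of_le zero_le_one] at ht
    have hlt := (hmem t ⟨ht.1.le, ht.2⟩ x hx).trans hρ2
    have ht0 : (t : ℂ) ≠ 0 := by exact_mod_cast ht.1.ne'
    have h1 : HasDerivAt (fun x : ℂ => 1 - (t : ℂ) * x) (-t) x := by
      simpa using ((hasDerivAt_id x).const_mul (t : ℂ)).const_sub 1
    have h2 := (h1.clog (one_sub_mem_slitPlane hlt)).div_const (t : ℂ)
    refine h2.congr_deriv ?_
    rw [div_div, mul_comm, ← div_div, neg_div, div_self ht0, neg_div, one_div]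

/-- By the Weierstrass M-test. Continuity up to the circle allows the constant in Landen's equation
to be read off at z → 1. -/
theorem continuousOn_dilog : ContinuousOn dilog (Metric.closedBall 0 1) := by
  have hs : Summable fun n : ℕ => 1 / ((n : ℝ) + 1) ^ 2 := by
    have := (summable_nat_add_iff 1).2 (Real.summable_one_div_nat_pow.2 one_lt_two)
    simpa using this
  have := continuousOn_tsum (f := fun (n : ℕ) (z : ℂ) => z ^ (n + 1) / ((n : ℂ) + 1) ^ 2)
    (s := Metric.closedBall 0 1) (fun n => by fun_prop) hs fun n z hz => by
      rw [mem_closedBall_zero_iff] at hz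
      have h2 : ‖(n : ℂ) + 1‖ = (n : ℝ) + 1 := by
        rw [show (n : ℂ) + 1 = ((n + 1 : ℕ) : ℂ) by push_cast; rfl, Complex.norm_natCast]
        push_cast; rfl
      rw [norm_div, norm_pow, norm_pow, h2]
      gcongr
      exact pow_le_one₀ (norm_nonneg _) hz
  refine this.congr fun z hz => ?_
  exact (hasSum_dilog (by simpa using hz)).tsum_eq.symm

/-! ### The Legendre chi function and Landen's equation. -/

noncomputable section

/-- The Legendre chi function `∑ z ^ (2 k + 1) / (2 k + 1) ^ 2`. -/
def legendreChi (z : ℂ) : ℂ := (dilog z - dilog (-z)) / 2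

end

theorem legendreChi_zero : legendreChi 0 = 0 := by simp [legendreChi]

theorem dilog_one : dilog 1 = (Real.pi : ℂ) ^ 2 / 6 := by
  have h := dilog_add_dilog_conj_exp (x := 0) (by simp)
  simp only [mul_zero, Complex.ofReal_zero, zero_mul, neg_zero, Complex.exp_zero] at h
  push_cast at h
  linear_combination h / 2

theorem dilog_neg_one : dilog (-1) = -(Real.pi : ℂ) ^ 2 / 12 := by
  have h := dilog_add_dilog_conj_exp (x := 1 / 2) (by norm_num)
  rw [show 2 * Real.pi * (1 / 2) = Real.pi by ring, Complex.exp_neg, Complex.exp_pi_mul_I] at h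
  push_cast at h
  rw [show (-1 : ℂ)⁻¹ = -1 by norm_num] at h
  linear_combination h / 2

theorem legendreChi_one : legendreChi 1 = (Real.pi : ℂ) ^ 2 / 8 := by
  rw [legendreChi, dilog_one, dilog_neg_one]; ring

theorem hasDerivAt_legendreChi {z : ℂ} (hz : ‖z‖ < 1) (hz0 : z ≠ 0) :
    HasDerivAt legendreChi ((Complex.log (1 + z) - Complex.log (1 - z)) / (2 * z)) z := by
  have h1 := hasDerivAt_dilog hz hz0
  have h2 := hasDerivAt_dilog (z := -z) (by simpa using hz) (neg_ne_zero.2 hz0)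
  have h3 : HasDerivAt (fun z => dilog (-z)) (-(Complex.log (1 - -z) / -z) * -1) z :=
    HasDerivAt.comp (h := fun z => -z) (h₂ := dilog) z h2 (hasDerivAt_neg z)
  refine ((h1.sub h3).div_const 2).congr_deriv ?_
  rw [sub_neg_eq_add]
  field_simp
  ring

theorem continuousOn_legendreChi : ContinuousOn legendreChi (Metric.closedBall 0 1) :=
  (continuousOn_dilog.sub (continuousOn_dilog.comp continuousOn_neg
    fun z hz => by simpa using hz)).div_const 2

theorem one_add_mem_slitPlane {z : ℂ} (hz : ‖z‖ < 1) : 1 + z ∈ Complex.slitPlane := by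
  simpa using one_sub_mem_slitPlane (z := -z) (by simpa using hz)

theorem one_add_re_pos {z : ℂ} (hz : ‖z‖ < 1) : 0 < (1 + z).re := by
  have := (Complex.abs_re_le_norm z).trans_lt hz
  rw [abs_lt] at this
  simp; linarith

theorem norm_cayley_lt_one {z : ℂ} (hz : 0 < z.re) : ‖(1 - z) / (1 + z)‖ < 1 := by
  have h1 : 1 + z ≠ 0 := fun h => by
    have := congrArg Complex.re h
    simp at this; linarith
  rw [norm_div, div_lt_one (norm_pos_iff.2 h1), ← sq_lt_sq₀ (norm_nonneg _) (norm_nonneg _),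
    Complex.sq_norm, Complex.sq_norm, Complex.normSq_apply, Complex.normSq_apply]
  simp
  nlinarith

theorem log_mul_of_re_pos {x y : ℂ} (hx : 0 < x.re) (hy : 0 < y.re) :
    Complex.log (x * y) = Complex.log x + Complex.log y := by
  have h1 := abs_lt.1 (Complex.abs_arg_lt_pi_div_two_iff.2 (Or.inl hx))
  have h2 := abs_lt.1 (Complex.abs_arg_lt_pi_div_two_iff.2 (Or.inl hy))
  refine Complex.log_mul (fun h => by simp [h] at hx) (fun h => by simp [h] at hy) ⟨?_, ?_⟩ <;>
    linarith

/-- With g = (1 - z)/(1 + z) one has 1 - g = z(1 + g); both factors lie in the right half-plane, so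
the logarithm splits without a branch jump. -/
theorem log_cayley {z : ℂ} (hz : ‖z‖ < 1) (hre : 0 < z.re) :
    Complex.log (1 + (1 - z) / (1 + z)) - Complex.log (1 - (1 - z) / (1 + z)) =
      -Complex.log z := by
  have h1 : 1 + z ≠ 0 := Complex.slitPlane_ne_zero (one_add_mem_slitPlane hz)
  have : 1 - (1 - z) / (1 + z) = z * (1 + (1 - z) / (1 + z)) := by field_simp; ring
  rw [this, log_mul_of_re_pos hre (one_add_re_pos (norm_cayley_lt_one hre))]
  ring

/-- Near 1, |log x| ≤ 2(1 - x), which reduces the claim to u log u → 0. This kills the product term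
of Landen's equation at the boundary. -/
theorem tendsto_log_mul_log_one_sub :
    Filter.Tendsto (fun x : ℝ => Real.log x * Real.log (1 - x)) (nhdsWithin 1 (Set.Iio 1))
      (nhds 0) := by
  have h0 : Filter.Tendsto (fun x : ℝ => 1 - x) (nhdsWithin 1 (Set.Iio 1))
      (nhdsWithin 0 (Set.Ioi 0)) := by
    refine tendsto_nhdsWithin_iff.2 ⟨?_, ?_⟩
    · have : Filter.Tendsto (fun x : ℝ => 1 - x) (nhds 1) (nhds (1 - 1)) :=
        (continuous_const.sub continuous_id).tendsto 1
      rw [sub_self] at this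
      exact this.mono_left nhdsWithin_le_nhds
    · filter_upwards [self_mem_nhdsWithin] with x hx
      simpa using hx
  have hxl := tendsto_log_mul_rpow_nhdsGT_zero zero_lt_one
  simp only [Real.rpow_one] at hxl
  have h1 := (hxl.comp h0).norm.const_mul 2
  rw [norm_zero, mul_zero] at h1
  refine squeeze_zero_norm' ?_ h1
  have : Set.Ioo (1 / 2 : ℝ) 1 ∈ nhdsWithin (1 : ℝ) (Set.Iio 1) :=
    Ioo_mem_nhdsLT (by norm_num)
  filter_upwards [this] with x hx
  have hx0 : 0 < x := by linarith [hx.1]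
  have hl := Real.one_sub_inv_le_log_of_pos hx0
  have hn := Real.log_nonpos hx0.le hx.2.le
  have hb : ‖Real.log x‖ ≤ 2 * (1 - x) := by
    rw [Real.norm_eq_abs, abs_of_nonpos hn]
    have : x⁻¹ - 1 ≤ 2 * (1 - x) := by
      rw [inv_eq_one_div, div_sub_one hx0.ne', div_le_iff₀ hx0]
      nlinarith [hx.1, hx.2]
    linarith
  simp only [Function.comp, norm_mul]
  have : ‖(1 - x : ℝ)‖ = 1 - x := by rw [Real.norm_of_nonneg]; linarith [hx.2]
  rw [this]
  nlinarith [norm_nonneg (Real.log (1 - x))]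

theorem hasDerivAt_cayley {z : ℂ} (h : 1 + z ≠ 0) :
    HasDerivAt (fun z : ℂ => (1 - z) / (1 + z)) (-2 / (1 + z) ^ 2) z := by
  refine (((hasDerivAt_id z).const_sub 1).div ((hasDerivAt_id z).const_add 1) h).congr_deriv ?_
  simp only [id]
  ring

/-- Landen's functional equation for the Legendre chi function. -/
theorem legendreChi_add_legendreChi_cayley {z : ℂ} (hz : ‖z‖ < 1) (hre : 0 < z.re) :
    legendreChi z + legendreChi ((1 - z) / (1 + z)) =
      (Real.pi : ℂ) ^ 2 / 8 +
        Complex.log z * (Complex.log (1 + z) - Complex.log (1 - z)) / 2 := by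
  set U : Set ℂ := {z | 0 < z.re} ∩ Metric.ball 0 1 with hU
  have hopen : IsOpen U := (isOpen_lt continuous_const Complex.continuous_re).inter
    Metric.isOpen_ball
  have hconv : Convex ℝ U := (convex_halfSpace_re_gt 0).inter (convex_ball 0 1)
  -- The derivative of `f` vanishes on the convex half-disc, so `f` is constant; letting real x → 1
  -- identifies the constant as χ(1) = π²/8.
  let f : ℂ → ℂ := fun z => legendreChi z + legendreChi ((1 - z) / (1 + z)) -
    Complex.log z * (Complex.log (1 + z) - Complex.log (1 - z)) / 2
  have hder : ∀ z ∈ U, HasDerivAt f 0 z := by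
    rintro z ⟨hre, hz⟩
    rw [mem_ball_zero_iff] at hz
    have hre' : 0 < z.re := hre
    have hz0 : z ≠ 0 := fun h => by simp [h] at hre'
    have h1 := Complex.slitPlane_ne_zero (one_add_mem_slitPlane hz)
    have h2 := Complex.slitPlane_ne_zero (one_sub_mem_slitPlane hz)
    have hg0 : (1 - z) / (1 + z) ≠ 0 := div_ne_zero h2 h1
    have d1 := hasDerivAt_legendreChi hz hz0
    have d2 := (hasDerivAt_legendreChi (norm_cayley_lt_one hre') hg0).comp z (hasDerivAt_cayley h1)
    have d3 := (((hasDerivAt_id z).const_add 1).clog (one_add_mem_slitPlane hz)).sub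
      (((hasDerivAt_id z).const_sub 1).clog (one_sub_mem_slitPlane hz))
    have d4 := ((Complex.hasDerivAt_log (Or.inl hre')).mul d3).div_const 2
    refine ((d1.add d2).sub d4).congr_deriv ?_
    rw [log_cayley hz hre']
    simp only [id, Pi.sub_apply]
    field_simp
    ring
  obtain ⟨c, hconst⟩ := hopen.exists_is_const_of_deriv_eq_zero hconv.isPreconnected
    (fun x hx => (hder x hx).differentiableAt.differentiableWithinAt)
    (fun x hx => (hder x hx).deriv)
  have hlim : Filter.Tendsto (fun x : ℝ => f x) (nhdsWithin 1 (Set.Iio 1))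
      (nhds ((Real.pi : ℂ) ^ 2 / 8)) := by
    have hmem : Set.Ioo (0 : ℝ) 1 ∈ nhdsWithin (1 : ℝ) (Set.Iio 1) := Ioo_mem_nhdsLT zero_lt_one
    have hofReal : Filter.Tendsto (fun x : ℝ => (x : ℂ)) (nhdsWithin 1 (Set.Iio 1)) (nhds 1) := by
      simpa using (Complex.continuous_ofReal.tendsto 1).mono_left nhdsWithin_le_nhds
    have t1 : Filter.Tendsto (fun x : ℝ => legendreChi x) (nhdsWithin 1 (Set.Iio 1))
        (nhds ((Real.pi : ℂ) ^ 2 / 8)) := by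
      rw [← legendreChi_one]
      refine (continuousOn_legendreChi 1 (by simp)).tendsto.comp
        (tendsto_nhdsWithin_iff.2 ⟨hofReal, ?_⟩)
      filter_upwards [hmem] with x hx
      simp [abs_of_pos hx.1, hx.2.le]
    have t2 : Filter.Tendsto (fun x : ℝ => legendreChi ((1 - x) / (1 + x)))
        (nhdsWithin 1 (Set.Iio 1)) (nhds 0) := by
      rw [← legendreChi_zero]
      have hc : Filter.Tendsto (fun x : ℝ => (1 - (x : ℂ)) / (1 + x)) (nhdsWithin 1 (Set.Iio 1))
          (nhds ((1 - 1) / (1 + 1))) :=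
        (hofReal.const_sub 1).div (hofReal.const_add 1) (by norm_num)
      rw [sub_self, zero_div] at hc
      refine (continuousOn_legendreChi 0 (by simp)).tendsto.comp
        (tendsto_nhdsWithin_iff.2 ⟨hc, ?_⟩)
      filter_upwards [hmem] with x hx
      simpa using (norm_cayley_lt_one (z := (x : ℂ)) (by simpa using hx.1)).le
    have t3 : Filter.Tendsto (fun x : ℝ => Complex.log x *
        (Complex.log (1 + x) - Complex.log (1 - x)) / 2) (nhdsWithin 1 (Set.Iio 1)) (nhds 0) := by
      have hr : Filter.Tendsto (fun x : ℝ => (Real.log x * Real.log (1 + x) -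
          Real.log x * Real.log (1 - x)) / 2) (nhdsWithin 1 (Set.Iio 1)) (nhds 0) := by
        have : ContinuousAt (fun x : ℝ => Real.log x * Real.log (1 + x)) 1 :=
          (Real.continuousAt_log one_ne_zero).mul
            ((continuousAt_const.add continuousAt_id).log (by norm_num))
        have := (this.tendsto.mono_left nhdsWithin_le_nhds).sub tendsto_log_mul_log_one_sub
        simpa using this.div_const 2
      have := (Complex.continuous_ofReal.tendsto 0).comp hr
      rw [Complex.ofReal_zero] at this
      refine this.congr' ?_
      filter_upwards [hmem] with x hx
      have h1 : 0 ≤ 1 + x := by linarith [hx.1]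
      have h2 : 0 ≤ 1 - x := by linarith [hx.2]
      simp only [Function.comp]
      push_cast [Complex.ofReal_log hx.1.le, Complex.ofReal_log h1, Complex.ofReal_log h2]
      ring
    simpa using (t1.add t2).sub t3
  have hzU : z ∈ U := ⟨hre, by simpa using hz⟩
  have hev : ∀ᶠ x : ℝ in nhdsWithin 1 (Set.Iio 1), f x = c := by
    filter_upwards [Ioo_mem_nhdsLT zero_lt_one] with x hx
    refine hconst _ ⟨by simpa using hx.1, ?_⟩
    simpa [abs_of_pos hx.1] using hx.2
  have := tendsto_nhds_unique (hlim.congr' hev) tendsto_const_nhds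
  have hz := hconst z hzU
  simp only [f] at hz
  linear_combination hz - this

/-! ### Special values at q = √(2 - √3) and the dilogarithm combination. -/

theorem sqrt_two_sub_sqrt_three_sq : √(2 - √3) ^ 2 = 2 - √3 := by
  apply Real.sq_sqrt
  nlinarith [Real.sq_sqrt (show (0 : ℝ) ≤ 3 by norm_num), Real.sqrt_nonneg 3]

theorem sqrt_two_sub_sqrt_three_eq : √(2 - √3) = √2 / (1 + √3) := by
  have h3 := Real.sq_sqrt (show (0 : ℝ) ≤ 3 by norm_num)
  have h2 := Real.sq_sqrt (show (0 : ℝ) ≤ 2 by norm_num)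
  have hp := Real.sqrt_nonneg 3
  rw [Real.sqrt_eq_iff_mul_self_eq_of_pos (by positivity), div_mul_div_comm, div_eq_iff (by positivity)]
  nlinarith

theorem sqrt_two_sub_sqrt_three_pos : 0 < √(2 - √3) := by
  rw [sqrt_two_sub_sqrt_three_eq]; positivity

theorem sqrt_two_sub_sqrt_three_lt_one : √(2 - √3) < 1 := by
  rw [sqrt_two_sub_sqrt_three_eq, div_lt_one (by positivity)]
  have : √2 < √3 := Real.sqrt_lt_sqrt (by norm_num) (by norm_num)
  linarith

theorem inv_sqrt_two_sub_sqrt_three : (√(2 - √3))⁻¹ = √(2 + √3) := by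
  rw [← Real.sqrt_inv]
  congr 1
  have h3 := Real.sq_sqrt (show (0 : ℝ) ≤ 3 by norm_num)
  have := sqrt_two_sub_sqrt_three_sq
  have h0 : 0 < 2 - √3 := this ▸ pow_pos sqrt_two_sub_sqrt_three_pos 2
  rw [inv_eq_iff_eq_inv, eq_comm]
  apply inv_eq_of_mul_eq_one_left
  nlinarith

theorem log_sqrt_two_sub_sqrt_three : Real.log (√(2 - √3)) = Real.log (2 - √3) / 2 := by
  rw [Real.log_sqrt]
  exact sqrt_two_sub_sqrt_three_sq ▸ (pow_pos sqrt_two_sub_sqrt_three_pos 2).le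

theorem exp_pi_div_four_mul_I :
    Complex.exp ((Real.pi / 4 : ℝ) * Complex.I) = (√2 : ℝ) / 2 * (1 + Complex.I) := by
  rw [Complex.exp_mul_I, ← Complex.ofReal_cos, ← Complex.ofReal_sin, Real.cos_pi_div_four,
    Real.sin_pi_div_four]
  push_cast; ring

theorem exp_neg_pi_div_four_mul_I :
    Complex.exp ((-(Real.pi / 4) : ℝ) * Complex.I) = (√2 : ℝ) / 2 * (1 - Complex.I) := by
  rw [Complex.exp_mul_I, ← Complex.ofReal_cos, ← Complex.ofReal_sin, Real.cos_neg, Real.sin_neg,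
    Real.cos_pi_div_four, Real.sin_pi_div_four]
  push_cast; ring

theorem one_add_sqrt_three_ne_zero : (1 : ℂ) + ((√3 : ℝ) : ℂ) ≠ 0 := by
  have : (0 : ℝ) < 1 + √3 := by positivity
  exact_mod_cast this.ne'

theorem sqrt_two_ofReal_sq : ((√2 : ℝ) : ℂ) ^ 2 = 2 := by
  exact_mod_cast Real.sq_sqrt (show (0 : ℝ) ≤ 2 by norm_num)

theorem sqrt_three_ofReal_sq : ((√3 : ℝ) : ℂ) ^ 2 = 3 := by
  exact_mod_cast Real.sq_sqrt (show (0 : ℝ) ≤ 3 by norm_num)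

theorem sqrt_mul_exp_pi_div_four :
    (√(2 - √3) : ℝ) * Complex.exp ((Real.pi / 4 : ℝ) * Complex.I) =
      (1 + Complex.I) / (1 + ((√3 : ℝ) : ℂ)) := by
  rw [exp_pi_div_four_mul_I, sqrt_two_sub_sqrt_three_eq]
  have := one_add_sqrt_three_ne_zero
  push_cast
  field_simp
  linear_combination (1 + Complex.I) * sqrt_two_ofReal_sq

theorem sqrt_mul_exp_neg_pi_div_four :
    (√(2 - √3) : ℝ) * Complex.exp ((-(Real.pi / 4) : ℝ) * Complex.I) =
      (1 - Complex.I) / (1 + ((√3 : ℝ) : ℂ)) := by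
  rw [exp_neg_pi_div_four_mul_I, sqrt_two_sub_sqrt_three_eq]
  have := one_add_sqrt_three_ne_zero
  push_cast
  field_simp
  linear_combination (1 - Complex.I) * sqrt_two_ofReal_sq

theorem log_ofReal_mul_exp {r θ : ℝ} (hr : 0 < r) (h1 : -Real.pi < θ) (h2 : θ ≤ Real.pi) :
    Complex.log (r * Complex.exp (θ * Complex.I)) = Real.log r + θ * Complex.I := by
  rw [Complex.log_ofReal_mul hr (Complex.exp_ne_zero _), Complex.log_exp (by simpa using h1)
    (by simpa using h2)]

/-- The arguments are w = q e^{iπ/4} and its conjugate, which the Cayley map exchanges because q² +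
√2 q = 1. Landen's equation then leaves π²/8 - (log w)(log w̄)/2. -/
theorem legendreChi_add_legendreChi_special :
    legendreChi ((1 + Complex.I) / (1 + ((√3 : ℝ) : ℂ))) +
      legendreChi ((1 - Complex.I) / (1 + ((√3 : ℝ) : ℂ))) =
      3 * (Real.pi : ℂ) ^ 2 / 32 - (Real.log √(2 - √3) : ℂ) ^ 2 / 2 := by
  set w : ℂ := (1 + Complex.I) / (1 + ((√3 : ℝ) : ℂ)) with hw
  set w' : ℂ := (1 - Complex.I) / (1 + ((√3 : ℝ) : ℂ)) with hw'
  have h3 := one_add_sqrt_three_ne_zero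
  have hq0 := sqrt_two_sub_sqrt_three_pos
  have hq1 := sqrt_two_sub_sqrt_three_lt_one
  have hre : 0 < w.re := by
    rw [hw, ← sqrt_mul_exp_pi_div_four, Complex.re_ofReal_mul, Complex.exp_ofReal_mul_I_re,
      Real.cos_pi_div_four]
    positivity
  have hre' : 0 < w'.re := by
    rw [hw', ← sqrt_mul_exp_neg_pi_div_four, Complex.re_ofReal_mul, Complex.exp_ofReal_mul_I_re,
      Real.cos_neg, Real.cos_pi_div_four]
    positivity
  have hn : ‖w‖ < 1 := by
    rw [hw, ← sqrt_mul_exp_pi_div_four, norm_mul, Complex.norm_exp_ofReal_mul_I, mul_one,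
      Complex.norm_real, Real.norm_of_nonneg hq0.le]
    exact hq1
  have hn' : ‖w'‖ < 1 := by
    rw [hw', ← sqrt_mul_exp_neg_pi_div_four, norm_mul, Complex.norm_exp_ofReal_mul_I, mul_one,
      Complex.norm_real, Real.norm_of_nonneg hq0.le]
    exact hq1
  have hrel : (1 - w) = w' * (1 + w) := by
    rw [hw, hw']
    field_simp
    linear_combination sqrt_three_ofReal_sq + Complex.I_sq
  have e1 : (1 - w) / (1 + w) = w' := by
    rw [hrel, mul_div_assoc, div_self (Complex.slitPlane_ne_zero (one_add_mem_slitPlane hn)),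
      mul_one]
  have e2 : (1 - w') / (1 + w') = w := by
    rw [div_eq_iff (Complex.slitPlane_ne_zero (one_add_mem_slitPlane hn'))]
    linear_combination hrel
  have key := legendreChi_add_legendreChi_cayley hn hre
  have hl := log_cayley hn' hre'
  rw [e2] at hl
  rw [e1, hl, hw, hw', ← sqrt_mul_exp_pi_div_four, ← sqrt_mul_exp_neg_pi_div_four,
    log_ofReal_mul_exp hq0 (by linarith [Real.pi_pos]) (by linarith [Real.pi_pos]),
    log_ofReal_mul_exp hq0 (by linarith [Real.pi_pos]) (by linarith [Real.pi_pos])] at key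
  rw [hw, hw', ← sqrt_mul_exp_pi_div_four, ← sqrt_mul_exp_neg_pi_div_four, key]
  push_cast
  linear_combination ((Real.pi : ℂ) ^ 2 / 32) * Complex.I_sq

/-- On the cut the principal logarithm of a negative number has imaginary part +π; this produces the
term -πi log r. -/
theorem dilog_inversion_one {r : ℝ} (hr : 1 < r) :
    dilog r = (Real.pi : ℂ) ^ 2 / 3 - dilog (r : ℂ)⁻¹ - Real.pi * Complex.I * Real.log r
      - Real.log r ^ 2 / 2 := by
  have := dilog_inversion hr (u := 1) (u' := 1) fun v hv => by
    have h1 : 0 < v⁻¹ - 1 := by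
      rw [sub_pos]; exact one_lt_inv₀ hv.1 |>.2 hv.2
    rw [show 1 - (v : ℂ)⁻¹ * 1 = ((v⁻¹ - 1 : ℝ) : ℂ) * -1 by push_cast; ring,
      Complex.log_ofReal_mul h1 (by norm_num),
      show 1 - (v : ℂ) * 1 = ((1 - v : ℝ) : ℂ) by push_cast; ring,
      ← Complex.ofReal_log (by linarith [hv.2]), show v⁻¹ - 1 = (1 - v) / v by
        rw [sub_div, div_self hv.1.ne', one_div],
      Real.log_div (by linarith [hv.2]) hv.1.ne']
    push_cast; ring
  rw [mul_one, mul_one, dilog_one, Complex.log_neg_one] at this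
  rw [this]; ring

theorem dilog_inversion_neg_one {r : ℝ} (hr : 1 < r) :
    dilog (-(r : ℂ)) = -(Real.pi : ℂ) ^ 2 / 6 - dilog (-(r : ℂ)⁻¹) - Real.log r ^ 2 / 2 := by
  have := dilog_inversion hr (u := -1) (u' := -1) fun v hv => by
    have h1 : 0 < v⁻¹ + 1 := by have := inv_pos.2 hv.1; linarith
    rw [show 1 - (v : ℂ)⁻¹ * -1 = ((v⁻¹ + 1 : ℝ) : ℂ) by push_cast; ring,
      show 1 - (v : ℂ) * -1 = ((1 + v : ℝ) : ℂ) by push_cast; ring,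
      ← Complex.ofReal_log h1.le, neg_neg, Complex.log_one,
      ← Complex.ofReal_log (by linarith [hv.1]), show v⁻¹ + 1 = (1 + v) / v by
        rw [add_div, div_self hv.1.ne', one_div],
      Real.log_div (by linarith [hv.1]) hv.1.ne']
    push_cast; ring
  rw [mul_neg_one, mul_neg_one, dilog_neg_one, neg_neg, Complex.log_one] at this
  rw [this]; ring

/-- The bound on θ gives e^{iθ} and 1 + v e^{-iθ} positive real parts, so the logarithm of their
product splits. -/
theorem dilog_inversion_exp {r θ : ℝ} (hr : 1 < r) (hθ : |θ| < Real.pi / 2) :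
    dilog (r * -Complex.exp (θ * Complex.I)) =
      dilog (-Complex.exp (θ * Complex.I)) + dilog (-Complex.exp (-θ * Complex.I))
      - dilog ((r : ℂ)⁻¹ * -Complex.exp (-θ * Complex.I)) - θ * Complex.I * Real.log r
      - Real.log r ^ 2 / 2 := by
  rw [abs_lt] at hθ
  have hcos : 0 < Real.cos θ := Real.cos_pos_of_mem_Ioo hθ
  have hpi := Real.pi_pos
  have hle : Complex.log (Complex.exp (θ * Complex.I)) = θ * Complex.I := by
    rw [Complex.log_exp] <;> simp <;> linarith
  have := dilog_inversion hr (u := -Complex.exp (θ * Complex.I))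
    (u' := -Complex.exp (-θ * Complex.I)) fun v hv => by
    have hv0 := hv.1
    have hvc : (v : ℂ) ≠ 0 := by exact_mod_cast hv0.ne'
    have hmul : Complex.exp (θ * Complex.I) * Complex.exp (-θ * Complex.I) = 1 := by
      rw [← Complex.exp_add]; simp
    rw [neg_mul] at hmul
    rw [show 1 - (v : ℂ)⁻¹ * -Complex.exp (θ * Complex.I) =
      ((v⁻¹ : ℝ) : ℂ) * (Complex.exp (θ * Complex.I) *
        (1 - v * -Complex.exp (-θ * Complex.I))) by
        push_cast
        field_simp
        linear_combination -(v : ℂ) * hmul, Complex.log_ofReal_mul (inv_pos.2 hv0), neg_neg,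
      log_mul_of_re_pos, Real.log_inv]
    · push_cast; ring
    · rwa [Complex.exp_ofReal_mul_I_re]
    · rw [← Complex.ofReal_neg, mul_neg, sub_neg_eq_add, Complex.add_re, Complex.one_re,
        Complex.re_ofReal_mul, Complex.exp_ofReal_mul_I_re, Real.cos_neg]
      positivity
    · refine mul_ne_zero (Complex.exp_ne_zero _) fun h => ?_
      have h := congrArg Complex.re h
      rw [← Complex.ofReal_neg, mul_neg, sub_neg_eq_add, Complex.add_re, Complex.one_re,
        Complex.re_ofReal_mul, Complex.exp_ofReal_mul_I_re, Real.cos_neg, Complex.zero_re] at h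
      nlinarith [mul_pos hv0 hcos]
  rw [neg_neg, hle] at this
  exact this

/-- Since -e^{∓iπ/4} = e^{±2πi·3/8}, this is the Bernoulli evaluation at x = 3/8. -/
theorem dilog_add_dilog_three_pi_div_four :
    dilog (-Complex.exp ((Real.pi / 4 : ℝ) * Complex.I)) +
      dilog (-Complex.exp ((-(Real.pi / 4) : ℝ) * Complex.I)) = -13 * (Real.pi : ℂ) ^ 2 / 96 := by
  have h := dilog_add_dilog_conj_exp (x := 3 / 8) (by norm_num)
  have e1 : Complex.exp ((2 * Real.pi * (3 / 8) : ℝ) * Complex.I) =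
      -Complex.exp ((-(Real.pi / 4) : ℝ) * Complex.I) := by
    rw [← Complex.exp_antiperiodic]
    congr 1; push_cast; ring
  have e2 : Complex.exp (-((2 * Real.pi * (3 / 8) : ℝ) * Complex.I)) =
      -Complex.exp ((Real.pi / 4 : ℝ) * Complex.I) := by
    rw [← Complex.exp_sub_pi_mul_I]
    congr 1; push_cast; ring
  rw [e1, e2] at h
  push_cast at h ⊢
  linear_combination h

/-- The arguments outside the unit disc are ±1/q and -q⁻¹ e^{±iπ/4}. Inversion sends them to radius
q, where the real ones assemble into -4χ(q) and the others into 2(χ(w) + χ(w̄)). The term with log(2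
- √3) cancels the imaginary part of Li₂(1/q). -/
theorem dilog_combination :
    -((Real.pi : ℂ) ^ 2 / 24)
      - 1 / 2 * Complex.I * (Real.pi : ℂ) * ((Real.log (2 - √3) : ℝ) : ℂ)
      - dilog ((√(2 - √3) : ℝ) : ℂ) + dilog (-((√(2 - √3) : ℝ) : ℂ))
      - dilog (-((√(2 + √3) : ℝ) : ℂ)) + dilog ((√(2 + √3) : ℝ) : ℂ)
      + dilog ((1 - Complex.I) / (1 + ((√3 : ℝ) : ℂ)))
      + dilog ((1 + Complex.I) / (1 + ((√3 : ℝ) : ℂ)))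
      + dilog ((1 + ((√3 : ℝ) : ℂ)) / (-1 + Complex.I))
      + dilog ((1 + ((√3 : ℝ) : ℂ)) / (-1 - Complex.I)) =
    3 * (Real.pi : ℂ) ^ 2 / 8 - 2 * (Real.log √(2 - √3) : ℂ) ^ 2
      - 4 * legendreChi ((√(2 - √3) : ℝ) : ℂ) := by
  have hq0 := sqrt_two_sub_sqrt_three_pos
  have hr : 1 < √(2 + √3) := by
    rw [← inv_sqrt_two_sub_sqrt_three]
    exact (one_lt_inv₀ hq0).2 sqrt_two_sub_sqrt_three_lt_one
  have hinv : ((√(2 + √3) : ℝ) : ℂ)⁻¹ = ((√(2 - √3) : ℝ) : ℂ) := by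
    rw [← inv_sqrt_two_sub_sqrt_three]; push_cast; rw [inv_inv]
  have hlog : Real.log (√(2 + √3)) = -Real.log (√(2 - √3)) := by
    rw [← inv_sqrt_two_sub_sqrt_three, Real.log_inv]
  have hlog2 : Real.log (2 - √3) = 2 * Real.log √(2 - √3) := by
    rw [log_sqrt_two_sub_sqrt_three]; ring
  have habs : |Real.pi / 4| < Real.pi / 2 := by
    rw [abs_of_pos (by positivity)]; linarith [Real.pi_pos]
  have a1 := dilog_inversion_one hr
  have a2 := dilog_inversion_neg_one hr
  have a3 := dilog_inversion_exp hr habs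
  have a4 := dilog_inversion_exp hr (θ := -(Real.pi / 4)) (by rwa [abs_neg])
  have a5 := dilog_add_dilog_three_pi_div_four
  have a6 := legendreChi_add_legendreChi_special
  rw [hinv, hlog] at a1 a2 a3 a4
  have h3 := one_add_sqrt_three_ne_zero
  have hI1 : (-1 + Complex.I) ≠ 0 := fun h => by simpa using congrArg Complex.im h
  have hI2 : (-1 - Complex.I) ≠ 0 := fun h => by simpa using congrArg Complex.im h
  have hqc : ((√(2 - √3) : ℝ) : ℂ) ≠ 0 := by exact_mod_cast hq0.ne'
  have hq2 : ((√(2 - √3) : ℝ) : ℂ) * ((1 + √3 : ℝ) : ℂ) = ((√2 : ℝ) : ℂ) := by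
    rw [sqrt_two_sub_sqrt_three_eq]
    push_cast
    field_simp
  push_cast at hq2
  have b1 : ((√(2 + √3) : ℝ) : ℂ) * -Complex.exp ((Real.pi / 4 : ℝ) * Complex.I) =
      (1 + ((√3 : ℝ) : ℂ)) / (-1 + Complex.I) := by
    rw [exp_pi_div_four_mul_I, ← inv_sqrt_two_sub_sqrt_three, Complex.ofReal_inv]
    field_simp
    rw [← hq2]
    linear_combination (((√(2 - √3) : ℝ) : ℂ) * (1 + ((√3 : ℝ) : ℂ))) * (-Complex.I_sq)
  have b2 : ((√(2 + √3) : ℝ) : ℂ) * -Complex.exp ((-(Real.pi / 4) : ℝ) * Complex.I) =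
      (1 + ((√3 : ℝ) : ℂ)) / (-1 - Complex.I) := by
    rw [exp_neg_pi_div_four_mul_I, ← inv_sqrt_two_sub_sqrt_three, Complex.ofReal_inv]
    field_simp
    rw [← hq2]
    linear_combination (((√(2 - √3) : ℝ) : ℂ) * (1 + ((√3 : ℝ) : ℂ))) * (-Complex.I_sq)
  rw [← Complex.ofReal_neg, b1] at a3
  rw [← Complex.ofReal_neg, b2, neg_neg] at a4
  rw [mul_neg, sqrt_mul_exp_neg_pi_div_four] at a3
  rw [mul_neg, sqrt_mul_exp_pi_div_four] at a4
  simp only [legendreChi] at a6 ⊢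
  rw [a1, a2, a3, a4, hlog2]
  push_cast at a5 ⊢
  linear_combination 2 * a5 + 2 * a6

/-! ### The arctangent integrals. -/

theorem arg_eq_arctan {z : ℂ} (hz : 0 < z.re) : z.arg = Real.arctan (z.im / z.re) := by
  have h := abs_lt.1 (Complex.abs_arg_lt_pi_div_two_iff.2 (Or.inl hz))
  rw [← Complex.tan_arg, Real.arctan_tan h.1 h.2]

theorem legendreChi_conj {z : ℂ} (hz : ‖z‖ ≤ 1) :
    legendreChi ((starRingEnd ℂ) z) = (starRingEnd ℂ) (legendreChi z) := by
  rw [legendreChi, legendreChi, ← map_neg, dilog_conj hz, dilog_conj (by simpa using hz)]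
  simp [map_ofNat]

theorem legendreChi_ofReal {x : ℝ} (hx : |x| ≤ 1) :
    ((legendreChi x).re : ℂ) = legendreChi x := by
  rw [← Complex.conj_eq_iff_re, ← legendreChi_conj (by simpa using hx), Complex.conj_ofReal]

/-- This equation is what singles out q: it makes 2q cos t/(1 - q²) equal to √2 cos t. -/
theorem two_mul_sqrt_two_sub_sqrt_three :
    2 * √(2 - √3) = √2 * (1 - √(2 - √3) ^ 2) := by
  have h3 := Real.sq_sqrt (show (0 : ℝ) ≤ 3 by norm_num)
  have hp : 1 + √3 ≠ 0 := by positivity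
  rw [sqrt_two_sub_sqrt_three_sq, sqrt_two_sub_sqrt_three_eq]
  field_simp
  linear_combination -h3

/-- On the curve z = q(sin t + i cos t) one has z' = -iz, so the derivative is arg(1 + z) - arg(1 -
z). The tangent addition formula merges the two arguments into arctan(2q cos t/(1 - q²)). -/
theorem hasDerivAt_re_legendreChi (t : ℝ) :
    HasDerivAt (fun t : ℝ => 2 * (legendreChi
      ((√(2 - √3) : ℝ) * (Complex.I * Complex.exp (-(t : ℂ) * Complex.I)))).re)
      (Real.arctan (√2 * Real.cos t)) t := by
  set q : ℝ := √(2 - √3) with hq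
  have hq0 : 0 < q := sqrt_two_sub_sqrt_three_pos
  have hq1 : q < 1 := sqrt_two_sub_sqrt_three_lt_one
  set z : ℂ := q * (Complex.I * Complex.exp (-(t : ℂ) * Complex.I)) with hz
  have hzz : z = (q * Real.sin t : ℝ) + (q * Real.cos t : ℝ) * Complex.I := by
    rw [hz, Complex.exp_mul_I, Complex.cos_neg, Complex.sin_neg]
    push_cast
    linear_combination (-(q : ℂ) * Complex.sin t) * Complex.I_sq
  have hre : z.re = q * Real.sin t := by rw [hzz]; simp [-Complex.ofReal_mul]
  have him : z.im = q * Real.cos t := by rw [hzz]; simp [-Complex.ofReal_mul]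
  have hn : ‖z‖ < 1 := by
    rw [hz, norm_mul, norm_mul, ← Complex.ofReal_neg, Complex.norm_exp_ofReal_mul_I,
      Complex.norm_I, Complex.norm_real, Real.norm_of_nonneg hq0.le]
    simpa using hq1
  have hz0 : z ≠ 0 := by
    rw [hz]
    have : (q : ℂ) ≠ 0 := by exact_mod_cast hq0.ne'
    exact mul_ne_zero this (mul_ne_zero Complex.I_ne_zero (Complex.exp_ne_zero _))
  have hcurve : HasDerivAt (fun t : ℝ => (q : ℂ) * (Complex.I * Complex.exp (-(t : ℂ) * Complex.I)))
      (-Complex.I * z) t := by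
    have h1 : HasDerivAt (fun t : ℝ => -(t : ℂ) * Complex.I) (-1 * Complex.I) t :=
      (Complex.ofRealCLM.hasDerivAt (x := t)).neg.mul_const Complex.I
    refine ((h1.cexp.const_mul Complex.I).const_mul (q : ℂ)).congr_deriv ?_
    rw [hz]; ring
  have h2 := (hasDerivAt_legendreChi hn hz0).comp t hcurve
  have h3 := (Complex.reCLM.hasFDerivAt.comp_hasDerivAt t h2).const_mul 2
  refine h3.congr_deriv ?_
  have e : (Complex.log (1 + z) - Complex.log (1 - z)) / (2 * z) * (-Complex.I * z) =
      (Complex.log (1 + z) - Complex.log (1 - z)) * (-Complex.I / 2) := by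
    field_simp
  have p1 : 0 < (1 + z).re := one_add_re_pos hn
  have p2 : 0 < (1 - z).re := by
    simpa [sub_eq_add_neg] using one_add_re_pos (z := -z) (by simpa using hn)
  rw [e]
  have e2 : 2 * Complex.reCLM ((Complex.log (1 + z) - Complex.log (1 - z)) * (-Complex.I / 2)) =
      (1 + z).arg - (1 - z).arg := by
    simp [Complex.log_im]
    ring
  rw [e2, arg_eq_arctan p1, arg_eq_arctan p2]
  rw [Complex.add_re, Complex.one_re, hre] at p1
  rw [Complex.sub_re, Complex.one_re, hre] at p2
  rw [Complex.add_re, Complex.add_im, Complex.sub_re, Complex.sub_im, Complex.one_re,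
    Complex.one_im, hre, him, zero_add, zero_sub, neg_div, Real.arctan_neg, sub_neg_eq_add]
  have hsc := Real.sin_sq_add_cos_sq t
  have hq2 : q ^ 2 < 1 := by nlinarith
  have hprod : 1 - q * Real.cos t / (1 + q * Real.sin t) *
      (q * Real.cos t / (1 - q * Real.sin t)) =
      (1 - q ^ 2) / ((1 + q * Real.sin t) * (1 - q * Real.sin t)) := by
    field_simp
    linear_combination -q ^ 2 * hsc
  have hpos : 0 < (1 - q ^ 2) / ((1 + q * Real.sin t) * (1 - q * Real.sin t)) :=
    div_pos (by linarith) (mul_pos p1 p2)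
  rw [Real.arctan_add (by linarith), hprod]
  congr 1
  have h1q : 1 - q ^ 2 ≠ 0 := by linarith
  have hkey := two_mul_sqrt_two_sub_sqrt_three
  rw [← hq] at hkey
  field_simp
  linear_combination Real.cos t * hkey

theorem continuous_arctan_sqrt_two_mul_cos :
    Continuous fun t : ℝ => Real.arctan (√2 * Real.cos t) :=
  Real.continuous_arctan.comp (by fun_prop)

/-- χ is odd and commutes with conjugation. Hence the primitive vanishes at t = 0. -/
theorem re_legendreChi_I_mul {x : ℝ} (hx : |x| ≤ 1) : (legendreChi (x * Complex.I)).re = 0 := by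
  have h := legendreChi_conj (z := x * Complex.I) (by simpa using hx)
  have h2 : legendreChi ((starRingEnd ℂ) (x * Complex.I)) = -legendreChi (x * Complex.I) := by
    simp [legendreChi]
    ring
  have := congrArg Complex.re (h2.symm.trans h)
  simp only [Complex.neg_re, Complex.conj_re] at this
  linarith

theorem integral_arctan_sqrt_two_mul_cos (b : ℝ) :
    ∫ t in (0 : ℝ)..b, Real.arctan (√2 * Real.cos t) = 2 * (legendreChi
      ((√(2 - √3) : ℝ) * (Complex.I * Complex.exp (-(b : ℂ) * Complex.I)))).re := by
  rw [intervalIntegral.integral_eq_sub_of_hasDerivAt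
    (fun t _ => hasDerivAt_re_legendreChi t)
    (continuous_arctan_sqrt_two_mul_cos.intervalIntegrable _ _)]
  have := re_legendreChi_I_mul (x := √(2 - √3)) (by
    rw [abs_of_pos sqrt_two_sub_sqrt_three_pos]; exact sqrt_two_sub_sqrt_three_lt_one.le)
  simp [this]

theorem integral_arctan_zero_pi_div_two :
    ∫ t in (0 : ℝ)..(Real.pi / 2), Real.arctan (√2 * Real.cos t) =
      2 * (legendreChi (√(2 - √3) : ℝ)).re := by
  rw [integral_arctan_sqrt_two_mul_cos]
  congr 4
  rw [Complex.exp_mul_I, Complex.cos_neg, Complex.sin_neg]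
  push_cast
  rw [Complex.cos_pi_div_two, Complex.sin_pi_div_two]
  linear_combination (-((√(2 - √3) : ℝ) : ℂ)) * Complex.I_sq

theorem integral_arctan_zero_pi_div_four :
    ∫ t in (0 : ℝ)..(Real.pi / 4), Real.arctan (√2 * Real.cos t) =
      3 * Real.pi ^ 2 / 32 - Real.log √(2 - √3) ^ 2 / 2 := by
  rw [integral_arctan_sqrt_two_mul_cos]
  have h := legendreChi_add_legendreChi_special
  rw [← sqrt_mul_exp_pi_div_four, ← sqrt_mul_exp_neg_pi_div_four] at h
  set q : ℝ := √(2 - √3) with hq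
  have hq0 : 0 < q := sqrt_two_sub_sqrt_three_pos
  have hq1 : q < 1 := sqrt_two_sub_sqrt_three_lt_one
  have hc : (q : ℂ) * Complex.exp ((-(Real.pi / 4) : ℝ) * Complex.I) =
      (starRingEnd ℂ) (q * Complex.exp ((Real.pi / 4 : ℝ) * Complex.I)) := by
    rw [map_mul, ← Complex.exp_conj, map_mul, Complex.conj_ofReal, Complex.conj_ofReal,
      Complex.conj_I]
    congr 2; push_cast; ring
  have hI : Complex.I * Complex.exp (-((Real.pi / 4 : ℝ) : ℂ) * Complex.I) =
      Complex.exp ((Real.pi / 4 : ℝ) * Complex.I) := by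
    rw [← Complex.ofReal_neg, exp_pi_div_four_mul_I, exp_neg_pi_div_four_mul_I]
    linear_combination (-((√2 : ℝ) : ℂ) / 2) * Complex.I_sq
  rw [hc, legendreChi_conj, Complex.add_conj] at h
  · rw [hI]
    exact_mod_cast h
  · rw [norm_mul, Complex.norm_exp_ofReal_mul_I, Complex.norm_real, Real.norm_of_nonneg hq0.le]
    linarith

theorem cos_add_sin_eq (x : ℝ) : Real.cos x + Real.sin x = √2 * Real.cos (Real.pi / 4 - x) := by
  have h2 := Real.sq_sqrt (show (0 : ℝ) ≤ 2 by norm_num)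
  rw [Real.cos_sub, Real.cos_pi_div_four, Real.sin_pi_div_four]
  linear_combination (-(Real.cos x + Real.sin x) / 2) * h2

theorem cos_sub_sin_eq (x : ℝ) : Real.cos x - Real.sin x = √2 * Real.cos (x + Real.pi / 4) := by
  have h2 := Real.sq_sqrt (show (0 : ℝ) ≤ 2 by norm_num)
  rw [Real.cos_add, Real.cos_pi_div_four, Real.sin_pi_div_four]
  linear_combination (-(Real.cos x - Real.sin x) / 2) * h2

/-- Since cos x ± sin x = √2 cos(π/4 ∓ x), the integral is that of arctan(√2 cos t) over [0, π/4]
minus that over [π/4, π/2]. -/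
theorem integral_arctan_cos_add_sin_sub :
    ∫ x in (0 : ℝ)..(Real.pi / 4),
      (Real.arctan (Real.cos x + Real.sin x) - Real.arctan (Real.cos x - Real.sin x)) =
      3 * Real.pi ^ 2 / 16 - Real.log √(2 - √3) ^ 2
        - 2 * (legendreChi (√(2 - √3) : ℝ)).re := by
  have hc := continuous_arctan_sqrt_two_mul_cos
  have h1 : ∫ x in (0 : ℝ)..(Real.pi / 4), Real.arctan (Real.cos x + Real.sin x) =
      ∫ t in (0 : ℝ)..(Real.pi / 4), Real.arctan (√2 * Real.cos t) := by
    simp_rw [cos_add_sin_eq]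
    rw [intervalIntegral.integral_comp_sub_left (fun t => Real.arctan (√2 * Real.cos t))]
    simp
  have h2 : ∫ x in (0 : ℝ)..(Real.pi / 4), Real.arctan (Real.cos x - Real.sin x) =
      ∫ t in (Real.pi / 4)..(Real.pi / 2), Real.arctan (√2 * Real.cos t) := by
    simp_rw [cos_sub_sin_eq]
    rw [intervalIntegral.integral_comp_add_right (fun t => Real.arctan (√2 * Real.cos t))]
    congr 1 <;> ring
  rw [intervalIntegral.integral_sub, h1, h2,
    ← intervalIntegral.integral_interval_sub_left (hc.intervalIntegrable 0 (Real.pi / 2))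
      (hc.intervalIntegrable 0 (Real.pi / 4)), integral_arctan_zero_pi_div_four,
    integral_arctan_zero_pi_div_two]
  · ring
  all_goals
    apply Continuous.intervalIntegrable
    exact Real.continuous_arctan.comp (by fun_prop)

/-- With θ = arctan x, the tangent of the difference is 2 sin θ/(1 + cos 2θ) = tan θ sec θ. -/
theorem arctan_cos_add_sin_sub_arctan (x : ℝ) :
    Real.arctan (Real.cos (Real.arctan x) + Real.sin (Real.arctan x)) -
      Real.arctan (Real.cos (Real.arctan x) - Real.sin (Real.arctan x)) =
      Real.arctan (x * √(1 + x ^ 2)) := by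
  have hs : 0 < √(1 + x ^ 2) := by positivity
  have hsq : √(1 + x ^ 2) ^ 2 = 1 + x ^ 2 := Real.sq_sqrt (by positivity)
  rw [Real.cos_arctan, Real.sin_arctan, sub_eq_add_neg (Real.arctan _), ← Real.arctan_neg]
  have hprod : 1 - (1 / √(1 + x ^ 2) + x / √(1 + x ^ 2)) *
      -(1 / √(1 + x ^ 2) - x / √(1 + x ^ 2)) = 2 / (1 + x ^ 2) := by
    have : 1 + x ^ 2 ≠ 0 := by positivity
    rw [mul_neg, sub_neg_eq_add, ← add_div, ← sub_div, div_mul_div_comm, ← sq, hsq]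
    field_simp
    ring
  have : 0 < 2 / (1 + x ^ 2) := by positivity
  rw [Real.arctan_add (by linarith), hprod]
  congr 1
  rw [div_eq_iff this.ne']
  field_simp
  linear_combination (-2 * x) * hsq

theorem integral_arctan_mul_sqrt_eq :
    ∫ x in (0 : ℝ)..1, Real.arctan (x * √(1 + x ^ 2)) / (1 + x ^ 2) =
      ∫ x in (0 : ℝ)..(Real.pi / 4),
        (Real.arctan (Real.cos x + Real.sin x) - Real.arctan (Real.cos x - Real.sin x)) := by
  have := intervalIntegral.integral_comp_mul_deriv (a := 0) (b := 1) (f := Real.arctan)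
    (f' := fun x => 1 / (1 + x ^ 2))
    (g := fun x => Real.arctan (Real.cos x + Real.sin x) - Real.arctan (Real.cos x - Real.sin x))
    (fun x _ => Real.hasDerivAt_arctan x)
    (Continuous.continuousOn (continuous_const.div (by fun_prop) fun x => by positivity))
    ((Real.continuous_arctan.comp (by fun_prop)).sub (Real.continuous_arctan.comp (by fun_prop)))
  rw [Real.arctan_zero, Real.arctan_one] at this
  rw [← this]
  refine intervalIntegral.integral_congr fun x _ => ?_
  simp only [Function.comp, arctan_cos_add_sin_sub_arctan]
  ring

theorem hasDerivAt_arctan_mul_sqrt (x : ℝ) :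
    HasDerivAt (fun x => Real.arctan (x * √(1 + x ^ 2)))
      ((1 + 2 * x ^ 2) / (√(1 + x ^ 2) * (1 + x ^ 2 + x ^ 4))) x := by
  have hp : 0 < 1 + x ^ 2 := by positivity
  have hs : 0 < √(1 + x ^ 2) := by positivity
  have hsq : √(1 + x ^ 2) ^ 2 = 1 + x ^ 2 := Real.sq_sqrt hp.le
  have h1 : HasDerivAt (fun x : ℝ => 1 + x ^ 2) (2 * x) x := by
    simpa using (hasDerivAt_pow 2 x).const_add 1
  have h2 := ((hasDerivAt_id x).mul (h1.sqrt hp.ne')).arctan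
  refine h2.congr_deriv ?_
  have e : 1 + (x * √(1 + x ^ 2)) ^ 2 = 1 + x ^ 2 + x ^ 4 := by rw [mul_pow, hsq]; ring
  have : 1 + x ^ 2 + x ^ 4 ≠ 0 := by positivity
  simp only [id, Pi.mul_apply, e]
  field_simp
  linear_combination hsq

theorem integral_arctan_by_parts :
    2 * ∫ x in (0 : ℝ)..1, Real.arctan (x * √(1 + x ^ 2)) / (1 + x ^ 2) =
      Real.pi / 2 * Real.arctan (√2) - 2 * ∫ x in (0 : ℝ)..1,
          (1 + 2 * x ^ 2) * Real.arctan x / (√(1 + x ^ 2) * (1 + x ^ 2 + x ^ 4)) := by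
  have h := intervalIntegral.integral_mul_deriv_eq_deriv_mul (a := 0) (b := 1)
    (fun x _ => hasDerivAt_arctan_mul_sqrt x) (fun x _ => Real.hasDerivAt_arctan x)
    (Continuous.intervalIntegrable (by
      refine Continuous.div (by fun_prop) (by fun_prop) fun x => ?_
      positivity) _ _)
    (Continuous.intervalIntegrable (continuous_const.div (by fun_prop) fun x => by positivity) _ _)
  have e1 : ∫ x in (0 : ℝ)..1, Real.arctan (x * √(1 + x ^ 2)) / (1 + x ^ 2) =
      ∫ x in (0 : ℝ)..1, Real.arctan (x * √(1 + x ^ 2)) * (1 / (1 + x ^ 2)) := by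
    congr 1; ext x; ring
  have e2 : ∫ x in (0 : ℝ)..1,
      (1 + 2 * x ^ 2) * Real.arctan x / (√(1 + x ^ 2) * (1 + x ^ 2 + x ^ 4)) =
      ∫ x in (0 : ℝ)..1,
      (1 + 2 * x ^ 2) / (√(1 + x ^ 2) * (1 + x ^ 2 + x ^ 4)) * Real.arctan x := by
    congr 1; ext x; ring
  rw [e1, e2, h, Real.arctan_one, Real.arctan_zero]
  norm_num
  ring

theorem two_mul_integral_arctan_eq :
    2 * ∫ x in (0 : ℝ)..1, Real.arctan (x * √(1 + x ^ 2)) / (1 + x ^ 2) =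
      3 * Real.pi ^ 2 / 8 - 2 * Real.log √(2 - √3) ^ 2
        - 4 * (legendreChi (√(2 - √3) : ℝ)).re := by
  rw [integral_arctan_mul_sqrt_eq, integral_arctan_cos_add_sin_sub]
  ring

/-! ### Numerical bounds. -/

theorem HasSum.le_sum_add_geometric {f : ℕ → ℝ} {a c r : ℝ} (hf : HasSum f a) (hr0 : 0 ≤ r)
    (hr1 : r < 1) (hbound : ∀ k, f k ≤ c * r ^ k) (N : ℕ) :
    a ≤ ∑ k ∈ Finset.range N, f k + c * r ^ N / (1 - r) := by
  have h1 := (hasSum_nat_add_iff' N).2 hf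
  have h2 := (hasSum_geometric_of_lt_one hr0 hr1).mul_left (c * r ^ N)
  have := hasSum_le (fun k => (hbound (k + N)).trans_eq (by rw [pow_add]; ring)) h1 h2
  rw [← div_eq_mul_inv] at this
  linarith

theorem sqrt_three_bounds : 1.7320508075688772 < √3 ∧ √3 < 1.7320508075688773 :=
  ⟨Real.lt_sqrt_of_sq_lt (by norm_num), (Real.sqrt_lt' (by norm_num)).2 (by norm_num)⟩

theorem sqrt_two_sub_sqrt_three_bounds :
    0.517638090205041 < √(2 - √3) ∧ √(2 - √3) < 0.517638090205042 := by
  have := sqrt_three_bounds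
  exact ⟨Real.lt_sqrt_of_sq_lt (by linarith), (Real.sqrt_lt' (by norm_num)).2 (by linarith)⟩

/-- Here 2 - √3 = (1 - √3/3)/(1 + √3/3), so the artanh series applies, with ratio 1/3. -/
theorem hasSum_log_two_sub_sqrt_three :
    HasSum (fun k : ℕ => 2 * √3 / 3 * ((1 / 3) ^ k / (2 * k + 1))) (-Real.log (2 - √3)) := by
  have h3 := Real.sq_sqrt (show (0 : ℝ) ≤ 3 by norm_num)
  have hb := sqrt_three_bounds
  have hpos : 0 < √3 / 3 := by positivity
  have h := Real.hasSum_log_sub_log_of_abs_lt_one (x := √3 / 3) (by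
    rw [abs_of_pos hpos]; linarith)
  have e : Real.log (1 + √3 / 3) - Real.log (1 - √3 / 3) = -Real.log (2 - √3) := by
    rw [← Real.log_div (by linarith) (by linarith), ← Real.log_inv]
    congr 1
    rw [inv_eq_one_div, div_eq_div_iff (by linarith) (by linarith)]
    linear_combination (-1 / 3) * h3
  rw [e] at h
  refine h.congr_fun fun k => ?_
  have : (√3 / 3) ^ (2 * k + 1) = √3 / 3 * (1 / 3) ^ k := by
    rw [pow_succ, pow_mul, div_pow, h3]
    norm_num; ring
  rw [this]; ring

theorem neg_log_two_sub_sqrt_three_bounds :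
    1.3169578969248 < -Real.log (2 - √3) ∧ -Real.log (2 - √3) < 1.316957896925 := by
  have hb := sqrt_three_bounds
  have h := hasSum_log_two_sub_sqrt_three
  -- The terms are nonnegative, so partial sums bound from below; after 28 terms the geometric tail
  -- is below 10⁻¹³.
  have lo := sum_le_hasSum (Finset.range 28) (fun k _ => by positivity) h
  have up := h.le_sum_add_geometric (c := 2 * √3 / 3) (r := 1 / 3) (by norm_num) (by norm_num)
    (fun k => by
      gcongr
      apply div_le_self (by positivity)
      have : (0 : ℝ) ≤ k := k.cast_nonneg
      linarith) 28
  rw [← Finset.mul_sum] at lo up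
  norm_num [Finset.sum_range_succ] at lo up
  constructor <;> linarith

theorem hasSum_legendreChi_re {q : ℝ} (h0 : 0 ≤ q) (h1 : q ≤ 1) :
    HasSum (fun k : ℕ => q * ((q ^ 2) ^ k / (2 * k + 1) ^ 2)) (legendreChi q).re := by
  have hn : ‖(q : ℂ)‖ ≤ 1 := by rw [Complex.norm_real, Real.norm_of_nonneg h0]; exact h1
  have h := ((hasSum_dilog hn).sub (hasSum_dilog (z := -q) (by rwa [norm_neg]))).div_const 2
  have inj : Function.Injective fun k : ℕ => 2 * k := fun a b hab => by simpa using hab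
  rw [← inj.hasSum_iff] at h
  · have := Complex.hasSum_re h
    refine this.congr_fun fun k => ?_
    have e : (((q : ℂ) ^ (2 * k + 1) / (((2 * k : ℕ) : ℂ) + 1) ^ 2 -
        (-(q : ℂ)) ^ (2 * k + 1) / (((2 * k : ℕ) : ℂ) + 1) ^ 2) / 2) =
        ((q * ((q ^ 2) ^ k / (2 * k + 1) ^ 2) : ℝ) : ℂ) := by
      rw [Odd.neg_pow (⟨k, rfl⟩ : Odd (2 * k + 1))]
      push_cast
      ring
    simp only [Function.comp]
    rw [e, Complex.ofReal_re]
  · intro n hn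
    have : Even (n + 1) := by
      rw [Nat.even_add_one, Nat.not_even_iff_odd]
      by_contra hodd
      obtain ⟨m, hm⟩ := Nat.not_odd_iff_even.1 hodd
      exact hn ⟨m, by simp only; omega⟩
    rw [this.neg_pow, sub_self, zero_div]

theorem legendreChi_re_bounds :
    0.534779372925 < (legendreChi (√(2 - √3) : ℝ)).re ∧
      (legendreChi (√(2 - √3) : ℝ)).re < 0.534779372926 := by
  have hb := sqrt_three_bounds
  have hq := sqrt_two_sub_sqrt_three_bounds
  have h := hasSum_legendreChi_re sqrt_two_sub_sqrt_three_pos.le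
    sqrt_two_sub_sqrt_three_lt_one.le
  rw [sqrt_two_sub_sqrt_three_sq] at h
  set s : ℝ := 2 - √3 with hs
  have s1 : 0.2679491924311227 ≤ s := by linarith
  have s2 : s ≤ 0.2679491924311228 := by linarith
  have hs0 : 0 ≤ s := by linarith
  -- After 22 terms the tail is below 2·10⁻¹³. Everything is monotone in s and √s, so decimal bounds
  -- may replace both.
  have lo := sum_le_hasSum (Finset.range 22) (fun k _ => by positivity) h
  have up := h.le_sum_add_geometric (c := √s) (r := s) hs0 (by linarith)
    (fun k => by
      gcongr
      apply div_le_self (by positivity)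
      have : (0 : ℝ) ≤ k := k.cast_nonneg
      nlinarith) 22
  rw [← Finset.mul_sum] at lo up
  have lo2 : 0.517638090205041 * ∑ k ∈ Finset.range 22,
      ((0.2679491924311227 : ℝ) ^ k / (2 * k + 1) ^ 2) ≤
      √s * ∑ k ∈ Finset.range 22, (s ^ k / (2 * (k : ℝ) + 1) ^ 2) := by
    gcongr
    exact hq.1.le
  have up2 : √s * ∑ k ∈ Finset.range 22, (s ^ k / (2 * (k : ℝ) + 1) ^ 2) ≤
      0.517638090205042 * ∑ k ∈ Finset.range 22,
      ((0.2679491924311228 : ℝ) ^ k / (2 * k + 1) ^ 2) := by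
    gcongr
    exact hq.2.le
  have up3 : √s * s ^ 22 / (1 - s) ≤
      0.517638090205042 * 0.2679491924311228 ^ 22 / (1 - 0.2679491924311228) := by
    have := hq.2.le
    have h1 : (0 : ℝ) < 1 - 0.2679491924311228 := by norm_num
    gcongr
  have lo4 : (0.534779372925 : ℝ) < 0.517638090205041 * ∑ k ∈ Finset.range 22,
      ((0.2679491924311227 : ℝ) ^ k / (2 * k + 1) ^ 2) := by
    norm_num [Finset.sum_range_succ]
  have up4 : 0.517638090205042 * ∑ k ∈ Finset.range 22,
      ((0.2679491924311228 : ℝ) ^ k / (2 * k + 1) ^ 2) +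
      0.517638090205042 * 0.2679491924311228 ^ 22 / (1 - 0.2679491924311228) <
      0.534779372926 := by
    norm_num [Finset.sum_range_succ]
  constructor <;> linarith

theorem integral_arctan_bounds :
    0.6947951075 ≤ 2 * ∫ x in (0 : ℝ)..1, Real.arctan (x * √(1 + x ^ 2)) / (1 + x ^ 2) ∧
      2 * ∫ x in (0 : ℝ)..1, Real.arctan (x * √(1 + x ^ 2)) / (1 + x ^ 2) < 0.6947951076 := by
  rw [two_mul_integral_arctan_eq, log_sqrt_two_sub_sqrt_three]
  obtain ⟨l1, l2⟩ := neg_log_two_sub_sqrt_three_bounds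
  obtain ⟨c1, c2⟩ := legendreChi_re_bounds
  have p1 := Real.pi_gt_d20
  have p2 := Real.pi_lt_d20
  have a1 : (3.14159265358979323846 : ℝ) ^ 2 ≤ Real.pi ^ 2 := by gcongr
  have a2 : Real.pi ^ 2 ≤ (3.14159265358979323847 : ℝ) ^ 2 := by gcongr
  have b1 : (1.3169578969248 : ℝ) ^ 2 ≤ (-Real.log (2 - √3)) ^ 2 := by gcongr
  have b2 : (-Real.log (2 - √3)) ^ 2 ≤ (1.316957896925 : ℝ) ^ 2 := by
    apply pow_le_pow_left₀ (by linarith) l2.le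
  rw [neg_sq] at b1 b2
  rw [div_pow]
  constructor <;> norm_num at * <;> linarith

/-! ### Change of variables: from parameters to sides. -/

noncomputable section

/-- The linear map of the plane with matrix `!![a, b; c, d]`. -/
def planeMap (a b c d : ℝ) : ℝ × ℝ →L[ℝ] ℝ × ℝ :=
  (Matrix.toLin (.finTwoProd ℝ) (.finTwoProd ℝ) !![a, b; c, d]).toContinuousLinearMap

/-- The sides `(a, b)` as a function of the parameters `(φ, ψ)`. -/
def sideMap (p : ℝ × ℝ) : ℝ × ℝ := (sideA p.1 p.2, sideB p.1 p.2)

/-- The pairs `(a, b)` for which `a`, `b`, `√(1 - a ^ 2 - b ^ 2)` are the sides of a triangle. -/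
def sideRegion : Set (ℝ × ℝ) :=
  {p | |p.1 - p.2| < √(1 - p.1 ^ 2 - p.2 ^ 2) ∧ √(1 - p.1 ^ 2 - p.2 ^ 2) < p.1 + p.2}

/-- The parameters `(φ, ψ)` in the open square that give a triangle. -/
def paramRegion : Set (ℝ × ℝ) :=
  Set.Ioo 0 (Real.pi / 2) ×ˢ Set.Ioo 0 (Real.pi / 2) ∩ sideMap ⁻¹' sideRegion

/-- The pairs of angles of a triangle. -/
def angleRegion : Set (ℝ × ℝ) :=
  {p | 0 < p.1 ∧ p.1 < Real.pi ∧ 0 < p.2 ∧ p.2 < Real.pi ∧ p.1 + p.2 < Real.pi}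

/-- The angles `(α, β)` as a function of the sides `(a, b)`. -/
def angleMap (p : ℝ × ℝ) : ℝ × ℝ :=
  (angleOpp p.1 p.2 √(1 - p.1 ^ 2 - p.2 ^ 2), angleOpp p.2 p.1 √(1 - p.1 ^ 2 - p.2 ^ 2))

/-- The sum of the squared sines of the angles of a triangle. -/
def sinSqSum (p : ℝ × ℝ) : ℝ :=
  Real.sin p.1 ^ 2 + Real.sin p.2 ^ 2 + Real.sin (p.1 + p.2) ^ 2

/-- The sides `(a, b)` of the triangle with angles `(α, β)` whose squared sides sum to `1`. -/
def sidesOfAngles (p : ℝ × ℝ) : ℝ × ℝ :=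
  (Real.sin p.1 * (√(sinSqSum p))⁻¹, Real.sin p.2 * (√(sinSqSum p))⁻¹)

end

theorem det_planeMap (a b c d : ℝ) : (planeMap a b c d).det = a * d - b * c := by
  rw [planeMap, LinearMap.det_toContinuousLinearMap, LinearMap.det_toLin, Matrix.det_fin_two_of]

theorem hasFDerivAt_planeMap {f g : ℝ × ℝ → ℝ} {a b c d : ℝ} {p : ℝ × ℝ}
    (hf : HasFDerivAt f (a • ContinuousLinearMap.fst ℝ ℝ ℝ + b • ContinuousLinearMap.snd ℝ ℝ ℝ) p)
    (hg : HasFDerivAt g (c • ContinuousLinearMap.fst ℝ ℝ ℝ + d • ContinuousLinearMap.snd ℝ ℝ ℝ) p) :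
    HasFDerivAt (fun p => (f p, g p)) (planeMap a b c d) p := by
  rw [planeMap, Matrix.toLin_finTwoProd_toContinuousLinearMap]
  exact hf.prodMk hg

/-- The change of variables formula as an identity of measures. Because of `hg0`, only the inclusion
of the support of `g` in the image has to be known. -/
theorem map_withDensity_eq_withDensity {F : ℝ × ℝ → ℝ × ℝ} {F' : ℝ × ℝ → ℝ × ℝ →L[ℝ] ℝ × ℝ}
    {s : Set (ℝ × ℝ)} (hs : MeasurableSet s) (hF' : ∀ x ∈ s, HasFDerivAt F (F' x) x)
    (hinj : Set.InjOn F s) (hF : Measurable F) {g h : ℝ × ℝ → ENNReal}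
    (hgh : ∀ x ∈ s, ENNReal.ofReal |(F' x).det| * g (F x) = h x)
    (hg0 : ∀ y, y ∉ F '' s → g y = 0) :
    ((volume.restrict s).withDensity h).map F = volume.withDensity g := by
  have hF'' : ∀ x ∈ s, HasFDerivWithinAt F (F' x) s x := fun x hx => (hF' x hx).hasFDerivWithinAt
  have himage : MeasurableSet (F '' s) := measurable_image_of_fderivWithin hs hF'' hinj
  ext B hB
  rw [Measure.map_apply hF hB, withDensity_apply _ (hF hB), withDensity_apply _ hB,
    ← lintegral_indicator (hF hB), ← lintegral_indicator hB,
    ← setLIntegral_eq_of_support_subset (f := B.indicator g) (s := F '' s),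
    lintegral_image_eq_lintegral_abs_det_fderiv_mul volume hs hF'' hinj]
  · refine setLIntegral_congr_fun hs fun x hx => ?_
    by_cases hxB : F x ∈ B
    · simp [Set.indicator, hxB, hgh x hx]
    · simp [Set.indicator, hxB]
  · intro y hy
    by_contra hys
    simp [hg0 y hys] at hy

theorem measurableSet_sideRegion : MeasurableSet sideRegion := by
  unfold sideRegion; measurability

theorem measurable_sideMap : Measurable sideMap := by
  unfold sideMap sideA sideB; fun_prop

theorem measurableSet_paramRegion : MeasurableSet paramRegion :=
  (measurableSet_Ioo.prod measurableSet_Ioo).inter (measurable_sideMap measurableSet_sideRegion)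

theorem measurableSet_angleRegion : MeasurableSet angleRegion := by
  unfold angleRegion; measurability

theorem formsTriangle_iff_mem_sideRegion (φ ψ : ℝ) :
    FormsTriangle (sideA φ ψ) (sideB φ ψ) (sideC φ ψ) ↔ sideMap (φ, ψ) ∈ sideRegion := by
  simp only [FormsTriangle, sideRegion, sideMap, Set.mem_ofPred_eq, sideC, abs_lt]
  constructor
  · rintro ⟨h1, h2, h3⟩
    exact ⟨⟨by linarith, by linarith⟩, h3⟩
  · rintro ⟨⟨h1, h2⟩, h3⟩
    exact ⟨by linarith, by linarith, h3⟩

theorem sideDensity_of_mem {p : ℝ × ℝ} (hp : p ∈ sideRegion) (C : ℝ) :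
    sideDensity C p.1 p.2 = C / (√(p.1 ^ 2 + p.2 ^ 2) * √(1 - p.1 ^ 2 - p.2 ^ 2)) :=
  if_pos hp

theorem sideDensity_of_notMem {p : ℝ × ℝ} (hp : p ∉ sideRegion) (C : ℝ) :
    sideDensity C p.1 p.2 = 0 :=
  if_neg hp

theorem angleDensity_of_mem {p : ℝ × ℝ} (hp : p ∈ angleRegion) (C : ℝ) :
    angleDensity C p.1 p.2 = C * Real.sin p.1 * Real.sin p.2 * Real.sin (p.1 + p.2) /
      (sinSqSum p * √(Real.sin p.1 ^ 2 + Real.sin p.2 ^ 2)) :=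
  if_pos hp

theorem angleDensity_of_notMem {p : ℝ × ℝ} (hp : p ∉ angleRegion) (C : ℝ) :
    angleDensity C p.1 p.2 = 0 :=
  if_neg hp

theorem sideDensity_eq_mul (C x y : ℝ) : sideDensity C x y = C * sideDensity 1 x y := by
  unfold sideDensity
  split_ifs <;> ring

theorem angleDensity_eq_mul (C x y : ℝ) : angleDensity C x y = C * angleDensity 1 x y := by
  unfold angleDensity
  split_ifs <;> ring

/-- The elementary facts about a point of the region of sides. -/
theorem sideRegion_pos {p : ℝ × ℝ} (hp : p ∈ sideRegion) :
    0 < p.1 ∧ 0 < p.2 ∧ 0 < 1 - p.1 ^ 2 - p.2 ^ 2 := by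
  obtain ⟨h1, h2⟩ := hp
  have h0 : 0 < √(1 - p.1 ^ 2 - p.2 ^ 2) := (abs_nonneg _).trans_lt h1
  rw [abs_lt] at h1
  exact ⟨by linarith, by linarith, Real.sqrt_pos.1 h0⟩

theorem sideMap_sq_add_sq (p : ℝ × ℝ) :
    (sideMap p).1 ^ 2 + (sideMap p).2 ^ 2 = Real.sin p.1 ^ 2 := by
  simp only [sideMap, sideA, sideB]
  linear_combination Real.sin p.1 ^ 2 * Real.sin_sq_add_cos_sq p.2

theorem sqrt_one_sub_sideMap {p : ℝ × ℝ} (hp : p.1 ∈ Set.Ioo 0 (Real.pi / 2)) :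
    √(1 - (sideMap p).1 ^ 2 - (sideMap p).2 ^ 2) = Real.cos p.1 := by
  have : 0 < Real.cos p.1 := Real.cos_pos_of_mem_Ioo ⟨by linarith [hp.1, Real.pi_pos], hp.2⟩
  rw [sub_sub, sideMap_sq_add_sq, ← Real.cos_sq', Real.sqrt_sq this.le]

theorem sin_pos_of_mem_Ioo_pi_div_two {x : ℝ} (hx : x ∈ Set.Ioo 0 (Real.pi / 2)) :
    0 < Real.sin x := Real.sin_pos_of_pos_of_lt_pi hx.1 (by linarith [hx.2, Real.pi_pos])

theorem hasFDerivAt_sideMap (p : ℝ × ℝ) :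
    HasFDerivAt sideMap (planeMap (Real.cos p.1 * Real.cos p.2) (-(Real.sin p.1 * Real.sin p.2))
      (Real.cos p.1 * Real.sin p.2) (Real.sin p.1 * Real.cos p.2)) p := by
  have s1 := (Real.hasDerivAt_sin p.1).comp_hasFDerivAt p (hasFDerivAt_fst (𝕜 := ℝ) (p := p))
  have s2 := (Real.hasDerivAt_sin p.2).comp_hasFDerivAt p (hasFDerivAt_snd (𝕜 := ℝ) (p := p))
  have c2 := (Real.hasDerivAt_cos p.2).comp_hasFDerivAt p (hasFDerivAt_snd (𝕜 := ℝ) (p := p))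
  refine hasFDerivAt_planeMap ((s1.mul c2).congr_fderiv ?_) ((s1.mul s2).congr_fderiv ?_)
  all_goals
    ext <;> simp; ring

theorem injOn_sideMap : Set.InjOn sideMap paramRegion := by
  rintro p ⟨⟨hp1, hp2⟩, -⟩ p' ⟨⟨hq1, hq2⟩, -⟩ h
  have hs := sideMap_sq_add_sq p
  rw [h, sideMap_sq_add_sq] at hs
  have sp := sin_pos_of_mem_Ioo_pi_div_two hp1
  have sq := sin_pos_of_mem_Ioo_pi_div_two hq1
  have hsin : Real.sin p.1 = Real.sin p'.1 := by
    rw [← abs_of_pos sp, ← abs_of_pos sq, ← sq_eq_sq_iff_abs_eq_abs, hs]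
  have e1 : p.1 = p'.1 := Real.injOn_sin ⟨by linarith [hp1.1, Real.pi_pos], hp1.2.le⟩
    ⟨by linarith [hq1.1, Real.pi_pos], hq1.2.le⟩ hsin
  have ha : Real.sin p.1 * Real.cos p.2 = Real.sin p'.1 * Real.cos p'.2 := congrArg Prod.fst h
  rw [hsin] at ha
  have e2 : p.2 = p'.2 := Real.injOn_cos ⟨hp2.1.le, by linarith [hp2.2, Real.pi_pos]⟩
    ⟨hq2.1.le, by linarith [hq2.2, Real.pi_pos]⟩ (mul_left_cancel₀ sq.ne' ha)
  exact Prod.ext e1 e2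

/-- Polar coordinates: sin φ = √(a² + b²) and tan ψ = b/a. -/
theorem sideRegion_subset_image : sideRegion ⊆ sideMap '' paramRegion := by
  intro p hp
  obtain ⟨h1, h2, h3⟩ := sideRegion_pos hp
  have hpos : 0 < p.1 ^ 2 + p.2 ^ 2 := by positivity
  set ρ := √(p.1 ^ 2 + p.2 ^ 2) with hρ
  have hρ0 : 0 < ρ := Real.sqrt_pos.2 hpos
  have hρ1 : ρ < 1 := by rw [hρ, Real.sqrt_lt' one_pos]; linarith
  have hρ2 : ρ ^ 2 = p.1 ^ 2 + p.2 ^ 2 := Real.sq_sqrt hpos.le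
  have hsqrt : √(1 + (p.2 / p.1) ^ 2) = ρ / p.1 := by
    rw [Real.sqrt_eq_iff_mul_self_eq_of_pos (by positivity)]
    field_simp
    linarith
  have hsin : Real.sin (Real.arcsin ρ) = ρ := Real.sin_arcsin (by linarith) hρ1.le
  have heq : sideMap (Real.arcsin ρ, Real.arctan (p.2 / p.1)) = p := by
    simp only [sideMap, sideA, sideB, hsin, Real.cos_arctan, Real.sin_arctan, hsqrt]
    refine Prod.ext ?_ ?_ <;> simp only <;> field_simp
  refine ⟨(Real.arcsin ρ, Real.arctan (p.2 / p.1)), ⟨⟨⟨?_, ?_⟩, ⟨?_, ?_⟩⟩, ?_⟩, heq⟩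
  · exact Real.arcsin_pos.2 hρ0
  · exact Real.arcsin_lt_pi_div_two.2 hρ1
  · exact Real.arctan_pos.2 (by positivity)
  · exact Real.arctan_lt_pi_div_two _
  · rw [Set.mem_preimage, heq]; exact hp

theorem map_sideMap_restrict_paramRegion :
    (volume.restrict paramRegion).map sideMap =
      volume.withDensity fun p => ENNReal.ofReal (sideDensity 1 p.1 p.2) := by
  have := map_withDensity_eq_withDensity measurableSet_paramRegion
    (fun p _ => hasFDerivAt_sideMap p) injOn_sideMap measurable_sideMap (h := 1)
    (g := fun p => ENNReal.ofReal (sideDensity 1 p.1 p.2)) ?_ ?_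
  · rwa [withDensity_one] at this
  · rintro p ⟨⟨hp1, hp2⟩, hp⟩
    have hs := sin_pos_of_mem_Ioo_pi_div_two hp1
    have hc : 0 < Real.cos p.1 := Real.cos_pos_of_mem_Ioo ⟨by linarith [hp1.1, Real.pi_pos], hp1.2⟩
    have hdet : Real.cos p.1 * Real.cos p.2 * (Real.sin p.1 * Real.cos p.2) -
        -(Real.sin p.1 * Real.sin p.2) * (Real.cos p.1 * Real.sin p.2) =
        Real.sin p.1 * Real.cos p.1 := by
      linear_combination Real.sin p.1 * Real.cos p.1 * Real.sin_sq_add_cos_sq p.2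
    rw [det_planeMap, hdet, abs_of_pos (by positivity), sideDensity_of_mem hp,
      sideMap_sq_add_sq, sqrt_one_sub_sideMap hp1, Real.sqrt_sq hs.le,
      ← ENNReal.ofReal_mul (by positivity), mul_one_div_cancel (by positivity)]
    simp
  · intro y hy
    rw [sideDensity_of_notMem fun h => hy (sideRegion_subset_image h)]
    simp

/-! ### From sides to angles. -/

theorem sin_pos_of_mem_angleRegion {p : ℝ × ℝ} (hp : p ∈ angleRegion) :
    0 < Real.sin p.1 ∧ 0 < Real.sin p.2 ∧ 0 < Real.sin (p.1 + p.2) := by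
  obtain ⟨h1, h2, h3, h4, h5⟩ := hp
  exact ⟨Real.sin_pos_of_pos_of_lt_pi h1 h2, Real.sin_pos_of_pos_of_lt_pi h3 h4,
    Real.sin_pos_of_pos_of_lt_pi (by linarith) h5⟩

theorem sinSqSum_pos {p : ℝ × ℝ} (hp : p ∈ angleRegion) : 0 < sinSqSum p := by
  obtain ⟨h1, h2, h3⟩ := sin_pos_of_mem_angleRegion hp
  unfold sinSqSum; positivity

theorem cos_mem_Ioo_of_mem_Ioo {x : ℝ} (h0 : 0 < x) (h1 : x < Real.pi) :
    -1 < Real.cos x ∧ Real.cos x < 1 := by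
  have := Real.sin_pos_of_pos_of_lt_pi h0 h1
  have := Real.sin_sq_add_cos_sq x
  constructor <;> nlinarith

theorem sqrt_one_sub_sidesOfAngles {p : ℝ × ℝ} (hp : p ∈ angleRegion) :
    √(1 - (sidesOfAngles p).1 ^ 2 - (sidesOfAngles p).2 ^ 2) =
      Real.sin (p.1 + p.2) * (√(sinSqSum p))⁻¹ := by
  have hQ := sinSqSum_pos hp
  have hw := (sin_pos_of_mem_angleRegion hp).2.2
  rw [Real.sqrt_eq_iff_mul_self_eq_of_pos (by positivity)]
  have h : (√(sinSqSum p))⁻¹ ^ 2 * sinSqSum p = 1 := by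
    rw [inv_pow, Real.sq_sqrt hQ.le, inv_mul_cancel₀ hQ.ne']
  simp only [sidesOfAngles]
  rw [sinSqSum] at h ⊢
  linear_combination h

/-- Triangle inequalities for sines: expand sin(x + y), and likewise sin x and sin y as sines of
differences, and use that all cosines lie strictly between -1 and 1. -/
theorem sidesOfAngles_mem_sideRegion {p : ℝ × ℝ} (hp : p ∈ angleRegion) :
    sidesOfAngles p ∈ sideRegion := by
  obtain ⟨h1, h2, h3⟩ := sin_pos_of_mem_angleRegion hp
  have hQ : 0 < (√(sinSqSum p))⁻¹ := inv_pos.2 (Real.sqrt_pos.2 (sinSqSum_pos hp))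
  have hs := Real.sin_add p.1 p.2
  have hc1 := cos_mem_Ioo_of_mem_Ioo hp.1 hp.2.1
  have hc2 := cos_mem_Ioo_of_mem_Ioo hp.2.2.1 hp.2.2.2.1
  have hc3 := cos_mem_Ioo_of_mem_Ioo (add_pos hp.1 hp.2.2.1) hp.2.2.2.2
  have e1 := Real.sin_sub (p.1 + p.2) p.2
  have e2 := Real.sin_sub (p.1 + p.2) p.1
  rw [add_sub_cancel_right] at e1
  rw [add_sub_cancel_left] at e2
  rw [sideRegion, Set.mem_ofPred_eq, sqrt_one_sub_sidesOfAngles hp]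
  simp only [sidesOfAngles]
  rw [← sub_mul, ← add_mul, abs_mul, abs_of_pos hQ]
  constructor
  · refine mul_lt_mul_of_pos_right (abs_lt.2 ⟨?_, ?_⟩) hQ <;> nlinarith
  · refine mul_lt_mul_of_pos_right ?_ hQ
    nlinarith

theorem angleOpp_mul_inv {x y z r : ℝ} (hr : r ≠ 0) :
    angleOpp (x * r) (y * r) (z * r) = angleOpp x y z := by
  unfold angleOpp
  congr 1
  rw [show (y * r) ^ 2 + (z * r) ^ 2 - (x * r) ^ 2 = (y ^ 2 + z ^ 2 - x ^ 2) * r ^ 2 by ring,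
    show 2 * (y * r) * (z * r) = 2 * y * z * r ^ 2 by ring, mul_div_mul_right _ _ (pow_ne_zero 2 hr)]

theorem angleOpp_sin {x y : ℝ} (hx0 : 0 < x) (hx1 : x < Real.pi) (hy : 0 < Real.sin y)
    (hxy : 0 < Real.sin (x + y)) :
    angleOpp (Real.sin x) (Real.sin y) (Real.sin (x + y)) = x := by
  have h : Real.sin y ^ 2 + Real.sin (x + y) ^ 2 - Real.sin x ^ 2 =
      Real.cos x * (2 * Real.sin y * Real.sin (x + y)) := by
    rw [Real.sin_add]
    linear_combination (-Real.sin y ^ 2) * Real.sin_sq_add_cos_sq x +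
      Real.sin x ^ 2 * Real.sin_sq_add_cos_sq y
  rw [angleOpp, h, mul_div_assoc, div_self (by positivity), mul_one, Real.arccos_cos hx0.le hx1.le]

theorem angleMap_sidesOfAngles {p : ℝ × ℝ} (hp : p ∈ angleRegion) :
    angleMap (sidesOfAngles p) = p := by
  obtain ⟨h1, h2, h3⟩ := sin_pos_of_mem_angleRegion hp
  have hQ : 0 < (√(sinSqSum p))⁻¹ := inv_pos.2 (Real.sqrt_pos.2 (sinSqSum_pos hp))
  rw [angleMap, sqrt_one_sub_sidesOfAngles hp]
  simp only [sidesOfAngles]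
  rw [angleOpp_mul_inv hQ.ne', angleOpp_mul_inv hQ.ne', angleOpp_sin hp.1 hp.2.1 h2 h3,
    add_comm p.1 p.2, angleOpp_sin hp.2.2.1 hp.2.2.2.1 h1 (by rwa [add_comm])]

theorem sideRegion_subset_image_sidesOfAngles : sideRegion ⊆ sidesOfAngles '' angleRegion := by
  intro p hp
  obtain ⟨hx, hy, hxy⟩ := sideRegion_pos hp
  obtain ⟨t1, t2⟩ := hp
  obtain ⟨x, y⟩ := p
  simp only at hx hy hxy t1 t2
  have hc2 : √(1 - x ^ 2 - y ^ 2) ^ 2 = 1 - x ^ 2 - y ^ 2 := Real.sq_sqrt hxy.le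
  set c := √(1 - x ^ 2 - y ^ 2) with hc
  have hc0 : 0 < c := Real.sqrt_pos.2 hxy
  rw [abs_lt] at t1
  have hK : 0 < (x + y + c) * (y + c - x) * (x + c - y) * (x + y - c) := by
    have a1 : 0 < x + y + c := by linarith
    have a2 : 0 < y + c - x := by linarith
    have a3 : 0 < x + c - y := by linarith
    have a4 : 0 < x + y - c := by linarith
    positivity
  -- By Heron's formula `K` is four times the area, so the sine of each angle is `K` over twice the
  -- product of the adjacent sides.
  set K := √((x + y + c) * (y + c - x) * (x + c - y) * (x + y - c)) with hKdef
  have hK0 : 0 < K := Real.sqrt_pos.2 hK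
  have hK2 : K ^ 2 = (x + y + c) * (y + c - x) * (x + c - y) * (x + y - c) := Real.sq_sqrt hK.le
  set X := (y ^ 2 + c ^ 2 - x ^ 2) / (2 * y * c) with hX
  set Y := (x ^ 2 + c ^ 2 - y ^ 2) / (2 * x * c) with hY
  have sX : 1 - X ^ 2 = (K / (2 * y * c)) ^ 2 := by
    rw [hX, div_pow, div_pow, hK2]; field_simp; ring
  have sY : 1 - Y ^ 2 = (K / (2 * x * c)) ^ 2 := by
    rw [hY, div_pow, div_pow, hK2]; field_simp; ring
  have bX : X ^ 2 < 1 := by have : 0 < (K / (2 * y * c)) ^ 2 := by positivity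
                            linarith
  have bY : Y ^ 2 < 1 := by have : 0 < (K / (2 * x * c)) ^ 2 := by positivity
                            linarith
  rw [sq_lt_one_iff_abs_lt_one, abs_lt] at bX bY
  have sinX : Real.sin (Real.arccos X) = K / (2 * y * c) := by
    rw [Real.sin_arccos, sX, Real.sqrt_sq (by positivity)]
  have sinY : Real.sin (Real.arccos Y) = K / (2 * x * c) := by
    rw [Real.sin_arccos, sY, Real.sqrt_sq (by positivity)]
  have cosX : Real.cos (Real.arccos X) = X := Real.cos_arccos bX.1.le bX.2.le
  have cosY : Real.cos (Real.arccos Y) = Y := Real.cos_arccos bY.1.le bY.2.le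
  have sinXY : Real.sin (Real.arccos X + Real.arccos Y) = K / (2 * x * y) := by
    rw [Real.sin_add, sinX, sinY, cosX, cosY, hX, hY]
    field_simp; ring
  have aX0 : 0 < Real.arccos X := Real.arccos_pos.2 bX.2
  have aY0 : 0 < Real.arccos Y := Real.arccos_pos.2 bY.2
  have aX1 : Real.arccos X < Real.pi :=
    lt_of_le_of_ne (Real.arccos_le_pi _) fun h => by
      rw [h, Real.cos_pi] at cosX; linarith
  have aY1 : Real.arccos Y < Real.pi :=
    lt_of_le_of_ne (Real.arccos_le_pi _) fun h => by
      rw [h, Real.cos_pi] at cosY; linarith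
  -- A sum in [π, 2π] would have nonpositive sine, against K/(2xy) > 0.
  have hsum : Real.arccos X + Real.arccos Y < Real.pi := by
    by_contra! h
    have h1 := Real.sin_nonneg_of_nonneg_of_le_pi (x := Real.arccos X + Real.arccos Y - Real.pi)
      (by linarith) (by linarith)
    rw [Real.sin_sub_pi, sinXY] at h1
    have : 0 < K / (2 * x * y) := by positivity
    linarith
  refine ⟨(Real.arccos X, Real.arccos Y), ⟨aX0, aX1, aY0, aY1, hsum⟩, ?_⟩
  have hQ : √(sinSqSum (Real.arccos X, Real.arccos Y)) = K / (2 * x * y * c) := by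
    rw [Real.sqrt_eq_iff_mul_self_eq_of_pos (by positivity), sinSqSum]
    simp only [sinX, sinY, sinXY]
    field_simp
    linear_combination -hc2
  simp only [sidesOfAngles, hQ, sinX, sinY]
  refine Prod.ext ?_ ?_ <;> simp only <;> field_simp

theorem measurable_angleMap : Measurable angleMap := by
  unfold angleMap angleOpp
  have := Real.continuous_arccos.measurable
  refine Measurable.prodMk (this.comp ?_) (this.comp ?_) <;> fun_prop

theorem measurable_sidesOfAngles : Measurable sidesOfAngles := by
  unfold sidesOfAngles sinSqSum; fun_prop

theorem hasFDerivAt_sinSqSum (p : ℝ × ℝ) :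
    HasFDerivAt sinSqSum
      ((2 * (Real.sin p.1 * Real.cos p.1 + Real.sin (p.1 + p.2) * Real.cos (p.1 + p.2))) •
          ContinuousLinearMap.fst ℝ ℝ ℝ +
        (2 * (Real.sin p.2 * Real.cos p.2 + Real.sin (p.1 + p.2) * Real.cos (p.1 + p.2))) •
          ContinuousLinearMap.snd ℝ ℝ ℝ) p := by
  have f1 := hasFDerivAt_fst (𝕜 := ℝ) (p := p)
  have f2 := hasFDerivAt_snd (𝕜 := ℝ) (p := p)
  have s1 := (Real.hasDerivAt_sin p.1).comp_hasFDerivAt p f1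
  have s2 := (Real.hasDerivAt_sin p.2).comp_hasFDerivAt p f2
  have s3 := (Real.hasDerivAt_sin (p.1 + p.2)).comp_hasFDerivAt p (f1.add f2)
  refine (((s1.pow 2).add (s2.pow 2)).add (s3.pow 2)).congr_fderiv ?_
  ext <;> simp <;> ring

theorem hasFDerivAt_sidesOfAngles {p : ℝ × ℝ} (hp : p ∈ angleRegion) {r m : ℝ}
    (hr : r = (√(sinSqSum p))⁻¹) (hm : m = r ^ 3) :
    HasFDerivAt sidesOfAngles (planeMap
      (Real.cos p.1 * r - Real.sin p.1 * m *
        (Real.sin p.1 * Real.cos p.1 + Real.sin (p.1 + p.2) * Real.cos (p.1 + p.2)))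
      (-(Real.sin p.1 * m *
        (Real.sin p.2 * Real.cos p.2 + Real.sin (p.1 + p.2) * Real.cos (p.1 + p.2))))
      (-(Real.sin p.2 * m *
        (Real.sin p.1 * Real.cos p.1 + Real.sin (p.1 + p.2) * Real.cos (p.1 + p.2))))
      (Real.cos p.2 * r - Real.sin p.2 * m *
        (Real.sin p.2 * Real.cos p.2 + Real.sin (p.1 + p.2) * Real.cos (p.1 + p.2)))) p := by
  have hQ := sinSqSum_pos hp
  have hs : √(sinSqSum p) ≠ 0 := (Real.sqrt_pos.2 hQ).ne'
  have s1 := (Real.hasDerivAt_sin p.1).comp_hasFDerivAt p (hasFDerivAt_fst (𝕜 := ℝ) (p := p))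
  have s2 := (Real.hasDerivAt_sin p.2).comp_hasFDerivAt p (hasFDerivAt_snd (𝕜 := ℝ) (p := p))
  have hd : HasDerivAt (fun q : ℝ => (√q)⁻¹) (-(r ^ 3 / 2)) (sinSqSum p) := by
    refine ((Real.hasDerivAt_sqrt hQ.ne').inv hs).congr_deriv ?_
    rw [hr]; field_simp
  have hR := hd.comp_hasFDerivAt p (hasFDerivAt_sinSqSum p)
  refine hasFDerivAt_planeMap ((s1.mul hR).congr_fderiv ?_) ((s2.mul hR).congr_fderiv ?_)
  all_goals
    rw [hm]
    ext <;> simp [← hr] <;> ring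

/-- The matrix is diagonal minus a rank-one term, so the r⁶ contributions cancel. Writing r² as r⁴Q
and using the addition formulas leaves r⁴w²(c1 c2 - c3). -/
theorem det_sidesOfAngles {u v w c1 c2 c3 r Q : ℝ} (hr : r ^ 2 * Q = 1)
    (hQ : Q = u ^ 2 + v ^ 2 + w ^ 2) (hw : w = u * c2 + c1 * v) (hc : c3 = c1 * c2 - u * v) :
    (c1 * r - u * r ^ 3 * (u * c1 + w * c3)) * (c2 * r - v * r ^ 3 * (v * c2 + w * c3)) -
      -(u * r ^ 3 * (v * c2 + w * c3)) * -(v * r ^ 3 * (u * c1 + w * c3)) =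
      u * v * w ^ 2 * r ^ 4 := by
  have h1 : (c1 * r - u * r ^ 3 * (u * c1 + w * c3)) * (c2 * r - v * r ^ 3 * (v * c2 + w * c3)) -
      -(u * r ^ 3 * (v * c2 + w * c3)) * -(v * r ^ 3 * (u * c1 + w * c3)) =
      c1 * c2 * r ^ 2 - r ^ 4 * ((u ^ 2 + v ^ 2) * (c1 * c2) + w * c3 * (u * c2 + c1 * v)) := by
    ring
  rw [h1, ← hw]
  have h2 : c1 * c2 * r ^ 2 = c1 * c2 * r ^ 4 * (u ^ 2 + v ^ 2 + w ^ 2) := by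
    rw [← hQ]; linear_combination (-c1 * c2 * r ^ 2) * hr
  rw [h2, hc]; ring

/-- Transporting from angles to sides avoids differentiating `Real.arccos`; the direction is
reversed afterwards because `angleMap` is a left inverse on `angleRegion`. -/
theorem map_sidesOfAngles_withDensity :
    ((volume.restrict angleRegion).withDensity
        fun p => ENNReal.ofReal (angleDensity 1 p.1 p.2)).map sidesOfAngles =
      volume.withDensity fun p => ENNReal.ofReal (sideDensity 1 p.1 p.2) := by
  refine map_withDensity_eq_withDensity measurableSet_angleRegion
    (fun p hp => hasFDerivAt_sidesOfAngles hp rfl rfl) ?_ measurable_sidesOfAngles ?_ ?_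
  · intro p hp p' hp' h
    rw [← angleMap_sidesOfAngles hp, h, angleMap_sidesOfAngles hp']
  · intro p hp
    obtain ⟨h1, h2, h3⟩ := sin_pos_of_mem_angleRegion hp
    have hQ := sinSqSum_pos hp
    have hr2 : ((√(sinSqSum p))⁻¹) ^ 2 * sinSqSum p = 1 := by
      rw [inv_pow, Real.sq_sqrt hQ.le, inv_mul_cancel₀ hQ.ne']
    have hr0 : 0 < (√(sinSqSum p))⁻¹ := by positivity
    have hsq : √((sidesOfAngles p).1 ^ 2 + (sidesOfAngles p).2 ^ 2) =
        √(Real.sin p.1 ^ 2 + Real.sin p.2 ^ 2) * (√(sinSqSum p))⁻¹ := by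
      simp only [sidesOfAngles]
      rw [mul_pow, mul_pow, ← add_mul, Real.sqrt_mul (by positivity), Real.sqrt_sq hr0.le]
    rw [det_planeMap, det_sidesOfAngles hr2 rfl (Real.sin_add _ _) (Real.cos_add _ _),
      abs_of_pos (by positivity), sideDensity_of_mem (sidesOfAngles_mem_sideRegion hp),
      angleDensity_of_mem hp, sqrt_one_sub_sidesOfAngles hp, hsq,
      ← ENNReal.ofReal_mul (by positivity)]
    congr 1
    set r := (√(sinSqSum p))⁻¹
    have hP : 0 < √(Real.sin p.1 ^ 2 + Real.sin p.2 ^ 2) := by positivity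
    rw [eq_div_iff (by positivity)]
    field_simp
    linear_combination hr2
  · intro y hy
    rw [sideDensity_of_notMem fun h => hy (sideRegion_subset_image_sidesOfAngles h)]
    simp

theorem map_angleMap_withDensity :
    (volume.withDensity fun p : ℝ × ℝ => ENNReal.ofReal (sideDensity 1 p.1 p.2)).map angleMap =
      volume.withDensity fun p => ENNReal.ofReal (angleDensity 1 p.1 p.2) := by
  rw [← map_sidesOfAngles_withDensity, Measure.map_map measurable_angleMap measurable_sidesOfAngles]
  have hac : ∀ᵐ p ∂((volume.restrict angleRegion).withDensity
      fun p => ENNReal.ofReal (angleDensity 1 p.1 p.2)), (angleMap ∘ sidesOfAngles) p = id p := by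
    refine (withDensity_absolutelyContinuous _ _).ae_le ?_
    filter_upwards [ae_restrict_mem measurableSet_angleRegion] with p hp
    exact angleMap_sidesOfAngles hp
  rw [Measure.map_congr hac, Measure.map_id,
    ← withDensity_indicator measurableSet_angleRegion]
  congr 1
  ext p
  by_cases hp : p ∈ angleRegion
  · simp [hp]
  · simp [hp, angleDensity_of_notMem hp]

/-! ### The area of the parameter region. -/

theorem cos_lt_sin_mul_iff {φ m : ℝ} (hφ : φ ∈ Set.Ioo 0 (Real.pi / 2)) :
    Real.cos φ < Real.sin φ * m ↔ Real.pi / 2 - Real.arctan m < φ := by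
  have hs := sin_pos_of_mem_Ioo_pi_div_two hφ
  rw [← div_lt_iff₀' hs, ← Real.arctan_lt_arctan_iff, ← inv_div, ← Real.tan_eq_sin_div_cos,
    ← Real.tan_pi_div_two_sub, Real.arctan_tan (by linarith [hφ.2, Real.pi_pos])
    (by linarith [hφ.1]), sub_lt_comm]

theorem sin_mul_lt_cos_iff {φ m : ℝ} (hφ : φ ∈ Set.Ioo 0 (Real.pi / 2)) :
    Real.sin φ * m < Real.cos φ ↔ φ < Real.pi / 2 - Real.arctan m := by
  have hs := sin_pos_of_mem_Ioo_pi_div_two hφ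
  rw [← lt_div_iff₀' hs, ← Real.arctan_lt_arctan_iff, ← inv_div, ← Real.tan_eq_sin_div_cos,
    ← Real.tan_pi_div_two_sub, Real.arctan_tan (by linarith [hφ.2, Real.pi_pos])
    (by linarith [hφ.1]), lt_sub_comm]

/-- Dividing |a - b| < c < a + b by sin φ > 0 confines cot φ to an interval, and π/2 - arctan m is
the angle in (0, π) with cotangent m. -/
theorem slice_paramRegion {ψ : ℝ} (hψ : ψ ∈ Set.Ioo 0 (Real.pi / 2)) :
    (fun φ => (φ, ψ)) ⁻¹' paramRegion =
      Set.Ioo (Real.pi / 2 - Real.arctan (Real.cos ψ + Real.sin ψ))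
        (Real.pi / 2 - Real.arctan |Real.cos ψ - Real.sin ψ|) := by
  ext φ
  have key : φ ∈ Set.Ioo 0 (Real.pi / 2) → (sideMap (φ, ψ) ∈ sideRegion ↔
      φ ∈ Set.Ioo (Real.pi / 2 - Real.arctan (Real.cos ψ + Real.sin ψ))
        (Real.pi / 2 - Real.arctan |Real.cos ψ - Real.sin ψ|)) := fun hφ => by
    have hs := sin_pos_of_mem_Ioo_pi_div_two hφ
    rw [sideRegion, Set.mem_ofPred_eq, sqrt_one_sub_sideMap (p := (φ, ψ)) hφ, Set.mem_Ioo,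
      ← cos_lt_sin_mul_iff hφ, ← sin_mul_lt_cos_iff hφ]
    simp only [sideMap, sideA, sideB]
    rw [← mul_sub, ← mul_add, abs_mul, abs_of_pos hs, and_comm]
  constructor
  · rintro ⟨⟨h1, -⟩, h2⟩
    exact (key h1).1 h2
  · intro h
    have h1 : φ ∈ Set.Ioo 0 (Real.pi / 2) := by
      have a1 := Real.arctan_lt_pi_div_two (Real.cos ψ + Real.sin ψ)
      have a2 := Real.arctan_nonneg.2 (abs_nonneg (Real.cos ψ - Real.sin ψ))
      exact ⟨by linarith [h.1], by linarith [h.2]⟩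
    exact ⟨⟨h1, hψ⟩, (key h1).2 h⟩

theorem volume_paramRegion_eq_lintegral :
    volume paramRegion = ∫⁻ ψ in Set.Ioo 0 (Real.pi / 2),
      ENNReal.ofReal (Real.arctan (Real.cos ψ + Real.sin ψ)
        - Real.arctan |Real.cos ψ - Real.sin ψ|) := by
  rw [Measure.volume_eq_prod, Measure.prod_apply_symm measurableSet_paramRegion,
    ← lintegral_indicator measurableSet_Ioo]
  refine lintegral_congr fun ψ => ?_
  by_cases hψ : ψ ∈ Set.Ioo 0 (Real.pi / 2)
  · rw [Set.indicator_of_mem hψ, slice_paramRegion hψ, Real.volume_Ioo]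
    congr 1; ring
  · have : (fun φ => (φ, ψ)) ⁻¹' paramRegion = ∅ :=
      Set.eq_empty_of_forall_notMem fun φ h => hψ h.1.2
    rw [Set.indicator_of_notMem hψ, this, measure_empty]

theorem continuous_arctan_add_sub_arctan_abs : Continuous fun ψ : ℝ =>
    Real.arctan (Real.cos ψ + Real.sin ψ) - Real.arctan |Real.cos ψ - Real.sin ψ| :=
  (Real.continuous_arctan.comp (by fun_prop)).sub (Real.continuous_arctan.comp (by fun_prop))

/-- The reflection ψ ↦ π/2 - ψ doubles the integral over [0, π/4], where cos ψ ≥ sin ψ removes the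
absolute value. -/
theorem integral_arctan_add_sub_arctan_abs :
    ∫ ψ in (0 : ℝ)..(Real.pi / 2),
      (Real.arctan (Real.cos ψ + Real.sin ψ) - Real.arctan |Real.cos ψ - Real.sin ψ|) =
      2 * ∫ x in (0 : ℝ)..1, Real.arctan (x * √(1 + x ^ 2)) / (1 + x ^ 2) := by
  set V : ℝ → ℝ := fun ψ =>
    Real.arctan (Real.cos ψ + Real.sin ψ) - Real.arctan |Real.cos ψ - Real.sin ψ| with hV
  have hVc : Continuous V := continuous_arctan_add_sub_arctan_abs
  have hpi := Real.pi_pos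
  have hsymm : ∀ ψ, V (Real.pi / 2 - ψ) = V ψ := fun ψ => by
    simp only [hV, Real.cos_pi_div_two_sub, Real.sin_pi_div_two_sub]
    rw [abs_sub_comm, add_comm]
  have h1 : ∫ ψ in (Real.pi / 4)..(Real.pi / 2), V ψ = ∫ ψ in (0 : ℝ)..(Real.pi / 4), V ψ := by
    have := intervalIntegral.integral_comp_sub_left V (Real.pi / 2) (a := 0) (b := Real.pi / 4)
    simp only [hsymm] at this
    rw [this]
    congr 1 <;> ring
  have h2 : ∫ ψ in (0 : ℝ)..(Real.pi / 4), V ψ = ∫ x in (0 : ℝ)..(Real.pi / 4),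
      (Real.arctan (Real.cos x + Real.sin x) - Real.arctan (Real.cos x - Real.sin x)) := by
    refine intervalIntegral.integral_congr fun x hx => ?_
    rw [Set.uIcc_of_le (by positivity)] at hx
    have : 0 ≤ Real.cos x - Real.sin x := by
      rw [cos_sub_sin_eq]
      exact mul_nonneg (Real.sqrt_nonneg _)
        (Real.cos_nonneg_of_mem_Icc ⟨by linarith [hx.1], by linarith [hx.2]⟩)
    simp only [hV, abs_of_nonneg this]
  rw [← intervalIntegral.integral_add_adjacent_intervals (hVc.intervalIntegrable 0 (Real.pi / 4))
    (hVc.intervalIntegrable _ _), h1, h2, integral_arctan_mul_sqrt_eq]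
  ring

theorem volume_paramRegion :
    volume paramRegion = ENNReal.ofReal
      (2 * ∫ x in (0 : ℝ)..1, Real.arctan (x * √(1 + x ^ 2)) / (1 + x ^ 2)) := by
  have hpi := Real.pi_pos
  rw [volume_paramRegion_eq_lintegral, ← integral_arctan_add_sub_arctan_abs,
    intervalIntegral.integral_of_le (by positivity), integral_Ioc_eq_integral_Ioo,
    ofReal_integral_eq_lintegral_ofReal]
  · exact (continuous_arctan_add_sub_arctan_abs.integrableOn_Icc (a := 0)
      (b := Real.pi / 2)).mono_set Set.Ioo_subset_Icc_self
  · filter_upwards [ae_restrict_mem measurableSet_Ioo] with ψ hψ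
    have hs := sin_pos_of_mem_Ioo_pi_div_two hψ
    have hc : 0 < Real.cos ψ := Real.cos_pos_of_mem_Ioo ⟨by linarith [hψ.1], hψ.2⟩
    refine sub_nonneg.2 (Real.arctan_strictMono.monotone ?_)
    rw [abs_le]
    constructor <;> linarith

/-! ### The conditional law and the conclusion. -/

/-- The boundary of the square is null, so the open square can serve; there all sines and cosines of
the parameters are positive. -/
theorem map_prodMk_eq_smul_restrict {Ω : Type*} [MeasurableSpace Ω] {P : Measure Ω}
    [IsProbabilityMeasure P] {φ ψ : Ω → ℝ} (hφ : Measurable φ) (hψ : Measurable ψ) {b : ℝ}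
    (hφU : pdf.IsUniform φ (Set.Icc 0 b) P volume)
    (hψU : pdf.IsUniform ψ (Set.Icc 0 b) P volume) (hindep : IndepFun φ ψ P) :
    P.map (fun ω => (φ ω, ψ ω)) = ((ENNReal.ofReal b)⁻¹ * (ENNReal.ofReal b)⁻¹) •
      (volume : Measure (ℝ × ℝ)).restrict (Set.Ioo 0 b ×ˢ Set.Ioo 0 b) := by
  rw [(indepFun_iff_map_prod_eq_prod_map_map hφ.aemeasurable hψ.aemeasurable).1 hindep,
    hφU, hψU, ProbabilityTheory.cond, Real.volume_Icc, sub_zero, Measure.prod_smul_left,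
    Measure.prod_smul_right, smul_smul, Measure.prod_restrict, ← Measure.volume_eq_prod]
  congr 1
  exact Measure.restrict_congr_set
    (Measure.set_prod_ae_eq Ioo_ae_eq_Icc Ioo_ae_eq_Icc).symm

/-- Conditionally on the triangle event, the parameters are uniform on their region. -/
theorem map_cond_eq_cond_paramRegion {Ω : Type*} [MeasurableSpace Ω] {P : Measure Ω}
    [IsProbabilityMeasure P] {φ ψ : Ω → ℝ} (hφ : Measurable φ) (hψ : Measurable ψ)
    (hφU : pdf.IsUniform φ (Set.Icc 0 (Real.pi / 2)) P volume)
    (hψU : pdf.IsUniform ψ (Set.Icc 0 (Real.pi / 2)) P volume) (hindep : IndepFun φ ψ P)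
    {T : Set Ω}
    (hT : T = {ω | FormsTriangle (sideA (φ ω) (ψ ω)) (sideB (φ ω) (ψ ω)) (sideC (φ ω) (ψ ω))}) :
    P T = (ENNReal.ofReal (Real.pi / 2))⁻¹ * (ENNReal.ofReal (Real.pi / 2))⁻¹ *
        volume paramRegion ∧
      (P[|T]).map (fun ω => (φ ω, ψ ω)) = (volume paramRegion)⁻¹ • volume.restrict paramRegion := by
  have hΦ : Measurable fun ω => (φ ω, ψ ω) := hφ.prodMk hψ
  set E : Set (ℝ × ℝ) := sideMap ⁻¹' sideRegion with hE
  have hEm : MeasurableSet E := measurable_sideMap measurableSet_sideRegion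
  have hTE : T = (fun ω => (φ ω, ψ ω)) ⁻¹' E := by
    rw [hT]; ext ω; exact formsTriangle_iff_mem_sideRegion _ _
  have hlaw := map_prodMk_eq_smul_restrict hφ hψ hφU hψU hindep
  set k := (ENNReal.ofReal (Real.pi / 2))⁻¹ * (ENNReal.ofReal (Real.pi / 2))⁻¹ with hk
  have hb0 : ENNReal.ofReal (Real.pi / 2) ≠ 0 := by
    rw [Ne, ENNReal.ofReal_eq_zero, not_le]; positivity
  have hk0 : k ≠ 0 := mul_ne_zero (ENNReal.inv_ne_zero.2 ENNReal.ofReal_ne_top)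
    (ENNReal.inv_ne_zero.2 ENNReal.ofReal_ne_top)
  have hkt : k ≠ ⊤ := ENNReal.mul_ne_top (ENNReal.inv_ne_top.2 hb0) (ENNReal.inv_ne_top.2 hb0)
  have hres : (P.restrict T).map (fun ω => (φ ω, ψ ω)) = k • volume.restrict paramRegion := by
    rw [hTE, ← Measure.restrict_map hΦ hEm, hlaw, Measure.restrict_smul,
      Measure.restrict_restrict hEm, Set.inter_comm]
    rfl
  have hPT : P T = k * volume paramRegion := by
    have := congrArg (fun μ => μ Set.univ) hres
    simpa [Measure.map_apply hΦ MeasurableSet.univ] using this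
  refine ⟨hPT, ?_⟩
  rw [ProbabilityTheory.cond, Measure.map_smul, hres, smul_smul, hPT,
    ENNReal.mul_inv (Or.inl hk0) (Or.inl hkt), mul_assoc, mul_comm _ k, ← mul_assoc,
    ENNReal.inv_mul_cancel hk0 hkt, one_mul]

theorem smul_withDensity_ofReal_eq {f g : ℝ × ℝ → ℝ} {C : ℝ} (hC : 0 ≤ C)
    (hfg : ∀ p, f p = C * g p) :
    ENNReal.ofReal C • (volume : Measure (ℝ × ℝ)).withDensity (fun p => ENNReal.ofReal (g p)) =
      volume.withDensity fun p => ENNReal.ofReal (f p) := by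
  rw [← withDensity_smul' _ _ ENNReal.ofReal_ne_top]
  congr 1
  ext p
  rw [hfg, ENNReal.ofReal_mul hC]
  rfl

theorem mainTheorem6 {Ω : Type*} [MeasurableSpace Ω] (P : Measure Ω) [IsProbabilityMeasure P]
    (φ ψ : Ω → ℝ) (hφ : Measurable φ) (hψ : Measurable ψ)
    (hφU : pdf.IsUniform φ (Set.Icc 0 (Real.pi / 2)) P volume)
    (hψU : pdf.IsUniform ψ (Set.Icc 0 (Real.pi / 2)) P volume)
    (hindep : IndepFun φ ψ P)
    (T : Set Ω)
    (hT : T = {ω | FormsTriangle (sideA (φ ω) (ψ ω)) (sideB (φ ω) (ψ ω)) (sideC (φ ω) (ψ ω))}) :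
    P T ≠ 0 ∧
    ∃ C : ℝ, 0 < C ∧
      -- the conditional joint density of the sides `a`, `b`
      (P[|T]).map (fun ω => (sideA (φ ω) (ψ ω), sideB (φ ω) (ψ ω))) =
        (volume : Measure (ℝ × ℝ)).withDensity
          (fun p => ENNReal.ofReal (sideDensity C p.1 p.2)) ∧
      -- the conditional joint density of the angles `α`, `β`
      (P[|T]).map (fun ω => (angleA (φ ω) (ψ ω), angleB (φ ω) (ψ ω))) =
        (volume : Measure (ℝ × ℝ)).withDensity
          (fun p => ENNReal.ofReal (angleDensity C p.1 p.2)) ∧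
      -- the normalizing constant
      1 / C = 2 * ∫ x in (0 : ℝ)..1, Real.arctan (x * √(1 + x ^ 2)) / (1 + x ^ 2) ∧
      1 / C = Real.pi / 2 * Real.arctan (√2) -
        2 * ∫ x in (0 : ℝ)..1,
          (1 + 2 * x ^ 2) * Real.arctan x / (√(1 + x ^ 2) * (1 + x ^ 2 + x ^ 4)) ∧
      ((1 / C : ℝ) : ℂ) =
        -((Real.pi : ℂ) ^ 2 / 24)
          - 1 / 2 * Complex.I * (Real.pi : ℂ) * ((Real.log (2 - √3) : ℝ) : ℂ)
          - dilog ((√(2 - √3) : ℝ) : ℂ) + dilog (-((√(2 - √3) : ℝ) : ℂ))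
          - dilog (-((√(2 + √3) : ℝ) : ℂ)) + dilog ((√(2 + √3) : ℝ) : ℂ)
          + dilog ((1 - Complex.I) / (1 + ((√3 : ℝ) : ℂ)))
          + dilog ((1 + Complex.I) / (1 + ((√3 : ℝ) : ℂ)))
          + dilog ((1 + ((√3 : ℝ) : ℂ)) / (-1 + Complex.I))
          + dilog ((1 + ((√3 : ℝ) : ℂ)) / (-1 - Complex.I)) ∧
      0.6947951075 ≤ 1 / C ∧ 1 / C < 0.6947951076 := by
  obtain ⟨hPT, hlaw⟩ := map_cond_eq_cond_paramRegion hφ hψ hφU hψU hindep hT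
  have hvol := volume_paramRegion
  have hparts := integral_arctan_by_parts
  have hval := two_mul_integral_arctan_eq
  obtain ⟨hlo, hhi⟩ := integral_arctan_bounds
  set J : ℝ := ∫ x in (0 : ℝ)..1, Real.arctan (x * √(1 + x ^ 2)) / (1 + x ^ 2)
  have hJ : 0 < 2 * J := lt_of_lt_of_le (by norm_num) hlo
  have hΦ : Measurable fun ω => (φ ω, ψ ω) := hφ.prodMk hψ
  have hC : (volume paramRegion)⁻¹ = ENNReal.ofReal (1 / (2 * J)) := by
    rw [hvol, one_div, ENNReal.ofReal_inv_of_pos hJ]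
  have hinv : 1 / (1 / (2 * J)) = 2 * J := one_div_one_div _
  have hside : (P[|T]).map (sideMap ∘ fun ω => (φ ω, ψ ω)) =
      ENNReal.ofReal (1 / (2 * J)) • (volume : Measure (ℝ × ℝ)).withDensity
        (fun p => ENNReal.ofReal (sideDensity 1 p.1 p.2)) := by
    rw [← hC, ← map_sideMap_restrict_paramRegion, ← Measure.map_smul, ← hlaw,
      Measure.map_map measurable_sideMap hΦ]
  -- The constant C is the reciprocal of the area 2J of `paramRegion`.
  refine ⟨?_, 1 / (2 * J), by positivity, ?_, ?_, ?_, ?_, ?_, ?_, ?_⟩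
  · rw [hPT, hvol]
    refine mul_ne_zero (mul_ne_zero ?_ ?_) ?_
    · exact ENNReal.inv_ne_zero.2 ENNReal.ofReal_ne_top
    · exact ENNReal.inv_ne_zero.2 ENNReal.ofReal_ne_top
    · rw [Ne, ENNReal.ofReal_eq_zero, not_le]
      exact hJ
  · refine Eq.trans ?_ (hside.trans
      (smul_withDensity_ofReal_eq (by positivity) fun p => sideDensity_eq_mul _ _ _))
    rfl
  · have := congrArg (Measure.map angleMap) hside
    rw [Measure.map_map measurable_angleMap (measurable_sideMap.comp hΦ), Measure.map_smul, map_angleMap_withDensity] at this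
    refine Eq.trans ?_ (this.trans
      (smul_withDensity_ofReal_eq (by positivity) fun p => angleDensity_eq_mul _ _ _))
    rfl
  · rw [hinv]
  · rw [hinv, hparts]
  · rw [hinv, hval, dilog_combination]
    -- The real formula involves Re χ(q) and the complex one χ(q); they agree because χ is real on
    -- [-1, 1].
    have hχ := legendreChi_ofReal (x := √(2 - √3)) (by
      rw [abs_of_pos sqrt_two_sub_sqrt_three_pos]; exact sqrt_two_sub_sqrt_three_lt_one.le)
    push_cast
    rw [hχ]
  · rw [hinv]; exact hlo
  · rw [hinv]; exact hhi
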